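/- Let $F=\mathbb{F}_q$ be a finite field, $n\ge 0$ an integer and $U=U_n(q)$ the group of upper triangular $n\times n$ matrices over $F$ with all diagonal entries $1$. Identify the positive roots of type $A_{n-1}$ with the positions $\alpha=(a,b)$, $1\le a<b\le n$ (row $a$, column $b$; $\alpha=\alpha_{a,b-1}=\alpha_a+\dots+\alpha_{b-1}$), and let $X_\alpha=\{I_n+c\,e_{a,b}: c\in F\}$ be the root subgroup of $\alpha$. Let $\mathrm{arm}(\alpha)=\{(a,l): a<l<b\}$ and let $V_\alpha\le U$ be the subgroup generated by all $X_\beta$ with $\beta\notin \mathrm{arm}(\alpha)$. Let $\mathrm{Irr}(V_\alpha/[V_\alpha,V_\alpha])^*$ denote the set of linear characters $\lambda$ of $V_\alpha$ that are nontrivial on $X_\alpha$ and trivial on every other root subgroup $X_\beta\subseteq V_\alpha$, $\beta\ne\alpha$. The induced characters $\lambda^U$, $\lambda\in \mathrm{Irr}(V_\alpha/[V_\alpha,V_\alpha])^*$, are the elementary characters at $\alpha$. Two positive roots are separate if they lie neither on the same row nor on the same column. A basic set is a nonempty set $D$ of pairwise separate positive roots; $E_D$ is the set of families $\phi=(\lambda_\alpha)_{\alpha\in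 D}$ with $\lambda_\alpha\in \mathrm{Irr}(V_\alpha/[V_\alpha,V_\alpha])^*$, and the basic character (supercharacter) attached to $(D,\phi)$ is $$\xi_{D,\phi}=\bigotimes_{\alpha\in D}{\lambda_\alpha}^U .$$ Write $\mathrm{Irr}(U)$ for the set of complex irreducible characters of $U$, $1_U$ for the trivial character, and $\mathrm{Irr}(\xi)\subseteq\mathrm{Irr}(U)$ for the set of irreducible constituents of a character $\xi$. **Theorem.** For every $\chi\in \mathrm{Irr}(U)$ with $\chi\ne 1_U$ there is exactly one pair $(D,\phi)$, with $D$ a basic set and $\phi\in E_D$, such that $\chi$ is a constituent of $\xi_{D,\phi}$. Consequently the basic characters partition $\mathrm{Irr}(U)$: the sets $\mathrm{Irr}(\xi_{D,\phi})$ are nonempty, do not contain $1_U$, are disjoint for distinct pairs $(D,\phi)$, and together with $\{1_U\}$ they cover $\mathrm{Irr}(U)$. -/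

import Mathlib

noncomputable section

namespace AndreChar

/-! Ordinary characters of a group. -/

section Characters

variable {G : Type*} [Group G]

/-- The complex characters of `G`: traces of finite-dimensional complex representations. Every
finite-dimensional complex space is isomorphic to some `ℂ^d`; `d = 0` gives the zero function. -/
def IsCharacter (χ : G → ℂ) : Prop :=
  ∃ (d : ℕ) (ρ : Representation ℂ G (Fin d → ℂ)), χ = ρ.character

/-- `Irr(G)`, the set of complex irreducible characters of `G`. -/
def Irr (G : Type*) [Group G] : Set (G → ℂ) :=
  {χ | ∃ (d : ℕ) (ρ : Representation ℂ G (Fin d → ℂ)), ρ.IsIrreducible ∧ χ = ρ.character}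

/-- `Irr(ξ)`, the set of irreducible constituents of `ξ`: those `χ ∈ Irr(G)` for which
`ξ = χ + ψ`, where `ψ` is a character or zero. -/
def constituents (ξ : G → ℂ) : Set (G → ℂ) :=
  {χ | χ ∈ Irr G ∧ ∃ ψ : G → ℂ, IsCharacter ψ ∧ ξ = χ + ψ}

open Classical in
/-- The character `lam^G` of the finite group `G` induced from a linear character `lam` of the
subgroup `H`:
`lam^G(g) = |H|⁻¹ ∑_{x ∈ G, x⁻¹ g x ∈ H} lam(x⁻¹ g x)`. -/
def inducedChar (H : Subgroup G) (lam : H →* ℂˣ) (g : G) : ℂ :=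
  (Nat.card H : ℂ)⁻¹ *
    ∑ᶠ x : G, if h : x⁻¹ * g * x ∈ H then ((lam ⟨x⁻¹ * g * x, h⟩ : ℂˣ) : ℂ) else 0

end Characters

/-! The group of upper unitriangular matrices and its root subgroups. -/

/-- The positive roots of type `A_{n-1}`: the root `α_{i,j} = α_i + ⋯ + α_j` with
`1 ≤ i ≤ j < n` is recorded by its matrix position `(i, j + 1)` above the diagonal
(with rows and columns numbered from `0` here). -/
abbrev PosRoot (n : ℕ) : Type := {p : Fin n × Fin n // p.1 < p.2}

/-- The row of a positive root. -/
def PosRoot.row {n : ℕ} (α : PosRoot n) : Fin n := α.1.1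

/-- The column of a positive root. -/
def PosRoot.col {n : ℕ} (α : PosRoot n) : Fin n := α.1.2

/-- `U_n(F)`: the upper triangular matrices with all diagonal entries equal to `1`. -/
def unitriangular (n : ℕ) (F : Type*) [Field F] : Subgroup (Matrix.GeneralLinearGroup (Fin n) F) where
  carrier := {g | (∀ i, g.1 i i = 1) ∧ ∀ i j, j < i → g.1 i j = 0}
  one_mem' := ⟨fun i => by simp, fun i j h => by simp [Matrix.one_apply_ne h.ne']⟩
  mul_mem' := by
    rintro a b ⟨ha, ha'⟩ ⟨hb, hb'⟩
    refine ⟨fun i => ?_, fun i j hij => ?_⟩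
    · rw [Units.val_mul, Matrix.mul_apply, Finset.sum_eq_single i]
      · rw [ha, hb, one_mul]
      · intro k _ hk
        rcases lt_or_gt_of_ne hk with h | h
        · rw [ha' i k h, zero_mul]
        · rw [hb' k i h, mul_zero]
      · simp
    · rw [Units.val_mul, Matrix.mul_apply]
      refine Finset.sum_eq_zero fun k _ => ?_
      rcases lt_or_ge k i with h | h
      · rw [ha' i k h, zero_mul]
      · rw [hb' k j (hij.trans_le h), mul_zero]
  inv_mem' := by
    rintro a ⟨ha, ha'⟩
    have hT : (a.1).BlockTriangular id := fun i j h => ha' i j h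
    have hI : ∀ i j, j < i → (a⁻¹).1 i j = 0 := by
      have : Invertible a.1 := a.invertible
      have h := Matrix.blockTriangular_inv_of_blockTriangular hT
      intro i j hij
      rw [Matrix.coe_units_inv]
      exact h hij
    refine ⟨fun i => ?_, hI⟩
    have h1 : (a.1 * (a⁻¹).1) i i = 1 := by
      rw [← Units.val_mul, mul_inv_cancel]; simp
    rw [Matrix.mul_apply, Finset.sum_eq_single i] at h1
    · rwa [ha, one_mul] at h1
    · intro k _ hk
      rcases lt_or_gt_of_ne hk with h | h
      · rw [ha' i k h, zero_mul]
      · rw [hI k i h, mul_zero]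
    · simp

/-- The group `U = U_n(F)`. -/
abbrev U (n : ℕ) (F : Type*) [Field F] : Type _ := unitriangular n F

variable {n : ℕ} {F : Type*} [Field F]

/-- The root element `x_α(c) = I_n + c • e_{row α, col α}` of `U`. -/
def rootElt (α : PosRoot n) (c : F) : U n F :=
  ⟨⟨Matrix.transvection α.row α.col c, Matrix.transvection α.row α.col (-c),
      by rw [Matrix.transvection_mul_transvection_same _ _ (show α.row ≠ α.col from α.2.ne), add_neg_cancel,
        Matrix.transvection_zero],
      by rw [Matrix.transvection_mul_transvection_same _ _ (show α.row ≠ α.col from α.2.ne), neg_add_cancel,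
        Matrix.transvection_zero]⟩, by
    have hα : α.row < α.col := α.2
    refine ⟨fun i => ?_, fun i j hij => ?_⟩
    · have h : ¬ (α.row = i ∧ α.col = i) := fun h => (h.1.trans h.2.symm ▸ hα).false
      simp [Matrix.transvection, h]
    · have h : ¬ (α.row = i ∧ α.col = j) := fun h => (h.1 ▸ h.2 ▸ hα).asymm hij
      simp [Matrix.transvection, h, Matrix.one_apply_ne hij.ne']⟩

/-- The root subgroup `X_α = {I_n + c • e_{row α, col α} : c ∈ F}`. -/
def rootSubgroup (F : Type*) [Field F] (α : PosRoot n) : Subgroup (U n F) where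
  carrier := Set.range (rootElt α)
  one_mem' := ⟨0, Subtype.ext (Units.ext (Matrix.transvection_zero _ _))⟩
  mul_mem' := by
    rintro _ _ ⟨c, rfl⟩ ⟨d, rfl⟩
    exact ⟨c + d, Subtype.ext (Units.ext
      (Matrix.transvection_mul_transvection_same _ _ α.2.ne c d).symm)⟩
  inv_mem' := by
    rintro _ ⟨c, rfl⟩
    exact ⟨-c, Subtype.ext (Units.ext rfl)⟩

/-- `arm(α_{i,j}) = {α_{i,l} : i ≤ l < j}`: the positive roots on the row of `α` strictly to the
left of `α`. -/
def arm (α : PosRoot n) : Set (PosRoot n) := {β | β.row = α.row ∧ β.col < α.col}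

/-- The base group `V_α`, generated by the root subgroups `X_β` with `β ∉ arm(α)`. -/
def baseGroup (F : Type*) [Field F] (α : PosRoot n) : Subgroup (U n F) :=
  ⨆ β ∈ (arm α)ᶜ, rootSubgroup F β

/-- The set `Irr(V_α / [V_α, V_α])^*` of those linear characters of `V_α` that are nontrivial on
`X_α` and trivial on all other root subgroups contained in `V_α`. -/
def baseLinChars (F : Type*) [Field F] (α : PosRoot n) : Set (baseGroup F α →* ℂˣ) :=
  {lam | (∃ v : baseGroup F α, (v : U n F) ∈ rootSubgroup F α ∧ lam v ≠ 1) ∧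
    ∀ β : PosRoot n, β ≠ α → rootSubgroup F β ≤ baseGroup F α →
      ∀ v : baseGroup F α, (v : U n F) ∈ rootSubgroup F β → lam v = 1}

/-- Two roots are separate if they are neither on the same row nor on the same column. -/
def Separate (α β : PosRoot n) : Prop := α.row ≠ β.row ∧ α.col ≠ β.col

/-- A basic set: a nonempty set of pairwise separate positive roots. -/
def IsBasic (D : Finset (PosRoot n)) : Prop :=
  D.Nonempty ∧ (D : Set (PosRoot n)).Pairwise Separate

/-- `E_D`: the families `(lam_α)_{α ∈ D}` with `lam_α ∈ Irr(V_α / [V_α, V_α])^*`. -/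
abbrev FamilyE (F : Type*) [Field F] (D : Finset (PosRoot n)) : Type _ :=
  (α : D) → baseLinChars F α.1

/-- The index set of the basic characters of `U_n(F)`: pairs `(D, φ)` of a basic set `D` and
`φ ∈ E_D`. -/
abbrev BasicIndex (n : ℕ) (F : Type*) [Field F] : Type _ :=
  Σ D : {D : Finset (PosRoot n) // IsBasic D}, FamilyE F D.1

/-- The basic character `ξ_{D,φ} = ⨂_{α ∈ D} (lam_α)^U`. The character of a tensor product is
the pointwise product of the characters. -/
def basicChar (p : BasicIndex n F) : U n F → ℂ :=
  ∏ α : p.1.1, inducedChar (baseGroup F α.1) (p.2 α).1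

end AndreChar

end

namespace AndreChar

/-! ### Characters, constituents and induction for finite groups. -/

section CharacterTheory

open Representation Module

variable {G : Type*} [Group G]

/-! Fix a nontrivial additive character `θ` of `F`. A matrix `A` gives the linear form `dot A` on
strictly upper triangular matrices, on which `U × U` acts, and `superSum θ A` sums `θ (dot A (x (g -
1) y))` over `x, y ∈ U`. It depends only on the orbit of the form (`superSum_eq_of_orbitRel`). Since
`g ↦ g - 1` is a bijection onto a vector space, orthogonality of additive characters makes sums of
different orbits orthogonal (`pairing_superSum_eq_zero`), and the sum over all forms is a multiple
of the regular character (`sum_superSum`).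

Gaussian elimination puts a rook matrix in every orbit (`exists_isRook_orbitRel`), and it is unique
(`IsRook.eq_of_orbitRel`). Nonzero rook matrices are the same as pairs `(D, φ)`: the support is `D`
and the entry at `α` is the parameter of `λ_α`. The link with characters is
`IsRook.prod_inducedChar`: `ξ_{D,φ}` is a nonzero multiple of the orbit sum of its rook matrix,
because an elementary character averages a function of a single row of `x`, and distinct rows are
independent.

Hence distinct basic characters are orthogonal and share no constituent. The zero orbit gives `1_U`.
Each irreducible `χ` pairs nontrivially with the regular character, hence with some orbit sum. -/

theorem isCharacter_character {V : Type*} [AddCommGroup V] [Module ℂ V] [FiniteDimensional ℂ V]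
    (ρ : Representation ℂ G V) : IsCharacter ρ.character := by
  let e : V ≃ₗ[ℂ] (Fin (finrank ℂ V) → ℂ) := (Module.finBasis ℂ V).equivFun
  let σ : Representation ℂ G (Fin (finrank ℂ V) → ℂ) :=
    { toFun := fun g => e.conj (ρ g)
      map_one' := by rw [map_one]; ext; simp [LinearEquiv.conj_apply]
      map_mul' := fun g h => by rw [map_mul]; ext; simp [LinearEquiv.conj_apply] }
  exact ⟨_, σ, char_iso (Representation.Equiv.mk (σ := σ) e fun g => by
    ext v; simp [σ, LinearEquiv.conj_apply])⟩

theorem IsCharacter.add {χ ψ : G → ℂ} (hχ : IsCharacter χ) (hψ : IsCharacter ψ) :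
    IsCharacter (χ + ψ) := by
  obtain ⟨d, ρ, rfl⟩ := hχ
  obtain ⟨e, σ, rfl⟩ := hψ
  have : ρ.character + σ.character = (ρ.prod σ).character := by
    ext g
    exact (LinearMap.trace_prodMap' (ρ g) (σ g)).symm
  rw [this]
  exact isCharacter_character _

theorem IsCharacter.mul {χ ψ : G → ℂ} (hχ : IsCharacter χ) (hψ : IsCharacter ψ) :
    IsCharacter (χ * ψ) := by
  obtain ⟨d, ρ, rfl⟩ := hχ
  obtain ⟨e, σ, rfl⟩ := hψ
  rw [← char_tensor]
  exact isCharacter_character _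

theorem isCharacter_zero : IsCharacter (0 : G → ℂ) :=
  ⟨0, Representation.trivial ℂ G _, by ext g; simp [character]⟩

theorem character_trivial_one : (Representation.trivial ℂ G (Fin 1 → ℂ)).character = 1 := by
  ext g; simp [character]

theorem isCharacter_one : IsCharacter (1 : G → ℂ) := ⟨1, _, character_trivial_one.symm⟩

theorem IsCharacter.prod {ι : Type*} (s : Finset ι) {χ : ι → G → ℂ}
    (h : ∀ i ∈ s, IsCharacter (χ i)) : IsCharacter (∏ i ∈ s, χ i) :=
  Finset.prod_induction _ _ (fun _ _ => IsCharacter.mul) isCharacter_one h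

theorem isIrreducible_of_finrank_eq_one {V : Type*} [AddCommGroup V] [Module ℂ V]
    (ρ : Representation ℂ G V) (h : finrank ℂ V = 1) : ρ.IsIrreducible := by
  have := (isSimpleModule_iff_finrank_eq_one (R := ℂ) (M := V)).2 h
  have : Nontrivial (Subrepresentation ρ) := by
    refine ⟨⊥, ⊤, fun h' => bot_ne_top (α := Submodule ℂ V) ?_⟩
    exact congrArg Subrepresentation.toSubmodule h'
  refine ⟨fun N => ?_⟩
  rcases eq_bot_or_eq_top N.toSubmodule with h | h
  · exact Or.inl (Subrepresentation.toSubmodule_injective h)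
  · exact Or.inr (Subrepresentation.toSubmodule_injective h)

theorem one_mem_Irr : (1 : G → ℂ) ∈ Irr G :=
  ⟨1, _, isIrreducible_of_finrank_eq_one (Representation.trivial ℂ G (Fin 1 → ℂ)) (by simp),
    character_trivial_one.symm⟩

theorem isCharacter_of_mem_Irr {χ : G → ℂ} (h : χ ∈ Irr G) : IsCharacter χ := by
  obtain ⟨d, ρ, -, rfl⟩ := h
  exact ⟨d, ρ, rfl⟩

theorem character_eq_add_of_isCompl {V : Type*} [AddCommGroup V] [Module ℂ V]
    [FiniteDimensional ℂ V] {ρ : Representation ℂ G V} {N N' : Subrepresentation ρ}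
    (h : IsCompl N N') :
    ρ.character = N.toRepresentation.character + N'.toRepresentation.character := by
  have hc : IsCompl N.toSubmodule N'.toSubmodule := by
    constructor
    · rw [disjoint_iff]
      exact congrArg Subrepresentation.toSubmodule (disjoint_iff.1 h.1)
    · rw [codisjoint_iff]
      exact congrArg Subrepresentation.toSubmodule (codisjoint_iff.1 h.2)
  let e := Submodule.prodEquivOfIsCompl _ _ hc
  have : (N.toRepresentation.prod N'.toRepresentation).character = ρ.character :=
    char_iso (Representation.Equiv.mk e fun g => by
      ext v <;> simp [e] <;> rfl)
  rw [← this]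
  ext g
  exact LinearMap.trace_prodMap' (N.toRepresentation g) (N'.toRepresentation g)

/-- The representation of `G` on functions on `G` by right translation. -/
def rightTranslation (G : Type*) [Group G] : Representation ℂ G (G → ℂ) where
  toFun g := LinearMap.funLeft ℂ ℂ (· * g)
  map_one' := by ext; simp [LinearMap.funLeft]
  map_mul' g h := by ext; simp [LinearMap.funLeft, mul_assoc]

theorem rightTranslation_apply (g x : G) (f : G → ℂ) :
    rightTranslation G g f x = f (x * g) := rfl

/-- The functions `f` on `G` with `f (h * x) = lam h * f x` for `h ∈ H`. -/
def inducedSubrep (H : Subgroup G) (lam : H →* ℂˣ) : Subrepresentation (rightTranslation G) where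
  toSubmodule :=
    { carrier := {f | ∀ (h : H) (x : G), f (h * x) = lam h * f x}
      add_mem' := fun hf hf' h x => by simp [hf h x, hf' h x, mul_add]
      zero_mem' := fun h x => by simp
      smul_mem' := fun c f hf h x => by simp [hf h x, mul_left_comm] }
  apply_mem_toSubmodule g f hf h x := by
    simp only [rightTranslation_apply, mul_assoc]
    exact hf h (x * g)

variable [Fintype G]

/-- The bilinear pairing `∑ g, a g * b g⁻¹` of functions on `G`. -/
def pairing (a b : G → ℂ) : ℂ := ∑ g, a g * b g⁻¹

theorem pairing_add_left (a b c : G → ℂ) : pairing (a + b) c = pairing a c + pairing b c := by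
  simp [pairing, add_mul, Finset.sum_add_distrib]

theorem pairing_comm (a b : G → ℂ) : pairing a b = pairing b a := by
  unfold pairing
  rw [← Equiv.sum_comp (Equiv.inv G)]
  simp [mul_comm]

theorem pairing_smul_left (c : ℂ) (a b : G → ℂ) : pairing (c • a) b = c * pairing a b := by
  simp [pairing, Finset.mul_sum, mul_assoc]

theorem pairing_add_right (a b c : G → ℂ) : pairing a (b + c) = pairing a b + pairing a c := by
  rw [pairing_comm, pairing_add_left, pairing_comm b, pairing_comm c]

theorem pairing_smul_right (c : ℂ) (a b : G → ℂ) : pairing a (c • b) = c * pairing a b := by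
  rw [pairing_comm, pairing_smul_left, pairing_comm]

theorem pairing_sum_right {ι : Type*} (s : Finset ι) (a : G → ℂ) (b : ι → G → ℂ) :
    pairing a (∑ i ∈ s, b i) = ∑ i ∈ s, pairing a (b i) := by
  simp only [pairing, Finset.sum_apply, Finset.mul_sum]
  exact Finset.sum_comm

theorem pairing_character {V W : Type*} [AddCommGroup V] [Module ℂ V] [FiniteDimensional ℂ V]
    [AddCommGroup W] [Module ℂ W] [FiniteDimensional ℂ W] (ρ : Representation ℂ G V)
    (σ : Representation ℂ G W) :
    pairing σ.character ρ.character = Nat.card G * finrank ℂ (IntertwiningMap ρ σ) := by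
  have : Invertible (Nat.card G : ℂ) :=
    invertibleOfNonzero (Nat.cast_ne_zero.2 Nat.card_pos.ne')
  rw [← card_inv_mul_sum_char_mul_char_eq_finrank, mul_inv_cancel_left₀ this.ne_zero, pairing]

/-- Pairings of characters are natural numbers, so in a sum of such pairings nothing can cancel the
contribution of a common constituent. -/
theorem IsCharacter.exists_pairing_eq {χ ψ : G → ℂ} (hχ : IsCharacter χ) (hψ : IsCharacter ψ) :
    ∃ m : ℕ, pairing χ ψ = m := by
  obtain ⟨d, ρ, rfl⟩ := hχ
  obtain ⟨e, σ, rfl⟩ := hψ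
  exact ⟨_, (pairing_character σ ρ).trans (Nat.cast_mul _ _).symm⟩

theorem pairing_self_of_mem_Irr {χ : G → ℂ} (h : χ ∈ Irr G) : pairing χ χ = Nat.card G := by
  obtain ⟨d, ρ, hρ, rfl⟩ := h
  rw [pairing_character, IsIrreducible.finrank_intertwiningMap_self, Nat.cast_one, mul_one]

/-- Two characters with a common constituent are not orthogonal. -/
theorem pairing_ne_zero_of_mem_constituents {χ ξ ξ' : G → ℂ} (h : χ ∈ constituents ξ)
    (h' : χ ∈ constituents ξ') : pairing ξ ξ' ≠ 0 := by
  obtain ⟨hχ, ψ, hψ, rfl⟩ := h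
  obtain ⟨-, ψ', hψ', rfl⟩ := h'
  have hχ' := isCharacter_of_mem_Irr hχ
  obtain ⟨a, ha⟩ := hχ'.exists_pairing_eq hψ'
  obtain ⟨b, hb⟩ := hψ.exists_pairing_eq (hχ'.add hψ')
  rw [pairing_add_left, pairing_add_right, pairing_self_of_mem_Irr hχ, ha, hb]
  have : 0 < Nat.card G := Nat.card_pos
  exact_mod_cast (by omega : Nat.card G + a + b ≠ 0)

theorem neZero_card : NeZero (Nat.card G : ℂ) := ⟨Nat.cast_ne_zero.2 Nat.card_pos.ne'⟩

/-- An irreducible character that is not orthogonal to a character is one of its constituents. -/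
theorem mem_constituents_of_pairing_ne_zero {χ ξ : G → ℂ} (hχ : χ ∈ Irr G) (hξ : IsCharacter ξ)
    (h : pairing ξ χ ≠ 0) : χ ∈ constituents ξ := by
  refine ⟨hχ, ?_⟩
  obtain ⟨d, ρ, hρ, rfl⟩ := hχ
  obtain ⟨e, σ, rfl⟩ := hξ
  rw [pairing_character] at h
  have := neZero_card (G := G)
  have hn : Nontrivial (IntertwiningMap ρ σ) := by
    by_contra hn
    rw [not_nontrivial_iff_subsingleton] at hn
    simp [finrank_zero_of_subsingleton] at h
  obtain ⟨T, hT⟩ := exists_ne (0 : IntertwiningMap ρ σ)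
  have hinj := (IsIrreducible.injective_or_eq_zero T).resolve_right hT
  obtain ⟨N, hN⟩ := exists_isCompl T.range
  refine ⟨_, isCharacter_character N.toRepresentation, ?_⟩
  rw [character_eq_add_of_isCompl hN]
  congr 1
  refine (char_iso (Representation.Equiv.mk
    (LinearEquiv.ofInjective T.toLinearMap hinj) fun g => ?_)).symm
  ext v
  have := LinearMap.congr_fun (T.isIntertwining' g) (Pi.single v 1)
  exact congrFun this _

/-- Induction on the degree: a reducible representation splits by Maschke, and a constituent of a
nonzero proper summand is one of the whole. The condition at `1` excludes degree zero. -/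
theorem exists_mem_constituents {ξ : G → ℂ} (hξ : IsCharacter ξ) (h1 : ξ 1 ≠ 0) :
    (constituents ξ).Nonempty := by
  obtain ⟨d, ρ, rfl⟩ := hξ
  induction d using Nat.strong_induction_on with
  | _ d ih =>
  have := neZero_card (G := G)
  by_cases hρ : ρ.IsIrreducible
  · exact ⟨_, ⟨d, ρ, hρ, rfl⟩, 0, isCharacter_zero, (add_zero _).symm⟩
  have hd : 0 < d := by
    by_contra hd
    obtain rfl : d = 0 := by omega
    simp at h1
  have hnt : Nontrivial (Subrepresentation ρ) := by
    have : Nontrivial (Fin d → ℂ) :=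
      Module.nontrivial_of_finrank_pos (R := ℂ) (by simpa using hd)
    refine ⟨⊥, ⊤, fun h' => bot_ne_top (α := Submodule ℂ (Fin d → ℂ)) ?_⟩
    exact congrArg Subrepresentation.toSubmodule h'
  obtain ⟨N, hN0, hN1⟩ : ∃ N : Subrepresentation ρ, N ≠ ⊥ ∧ N ≠ ⊤ := by
    by_contra! hN
    exact hρ ⟨fun N => or_iff_not_imp_left.2 (hN N)⟩
  obtain ⟨N', hNN'⟩ := exists_isCompl N
  have hlt : finrank ℂ N.toSubmodule < d := by
    have := Submodule.finrank_lt (s := N.toSubmodule)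
      fun h => hN1 (Subrepresentation.toSubmodule_injective h)
    simpa using this
  have hpos : finrank ℂ N.toSubmodule ≠ 0 := fun h =>
    hN0 (Subrepresentation.toSubmodule_injective (Submodule.finrank_eq_zero.1 h))
  obtain ⟨e, σ, hσ⟩ := isCharacter_character N.toRepresentation
  have he : (finrank ℂ N.toSubmodule : ℂ) = e := by
    rw [← char_one N.toRepresentation, hσ, char_one]; simp
  have he' : finrank ℂ N.toSubmodule = e := by exact_mod_cast he
  obtain ⟨χ, hχ, ψ, hψ, h⟩ := ih e (he' ▸ hlt) σ (by
    rw [char_one]; simpa [← he'] using hpos)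
  refine ⟨χ, hχ, _, hψ.add (isCharacter_character N'.toRepresentation), ?_⟩
  rw [character_eq_add_of_isCompl hNN', hσ, h, add_assoc]

open Classical in
/-- The averaging projection of functions on `G` onto `inducedSubrep H lam`. -/
noncomputable def inducedProj (H : Subgroup G) (lam : H →* ℂˣ) : (G → ℂ) →ₗ[ℂ] (G → ℂ) where
  toFun f x := (Nat.card H : ℂ)⁻¹ * ∑ h : H, ((lam h)⁻¹ : ℂˣ) * f (h * x)
  map_add' f f' := by ext x; simp [mul_add, Finset.sum_add_distrib]
  map_smul' c f := by ext x; simp [Finset.mul_sum, mul_left_comm]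

open Classical in
theorem inducedProj_apply (H : Subgroup G) (lam : H →* ℂˣ) (f : G → ℂ) (x : G) :
    inducedProj H lam f x = (Nat.card H : ℂ)⁻¹ * ∑ h : H, ((lam h)⁻¹ : ℂˣ) * f (h * x) := rfl

theorem inducedProj_mem (H : Subgroup G) (lam : H →* ℂˣ) (f : G → ℂ) :
    inducedProj H lam f ∈ (inducedSubrep H lam).toSubmodule := by
  classical
  intro k x
  simp only [inducedProj_apply]
  rw [mul_left_comm]
  congr 1
  rw [Finset.mul_sum]
  refine Fintype.sum_equiv (Equiv.mulRight k) _ _ fun h => ?_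
  simp [mul_assoc]

theorem inducedProj_of_mem (H : Subgroup G) (lam : H →* ℂˣ) {f : G → ℂ}
    (hf : f ∈ (inducedSubrep H lam).toSubmodule) : inducedProj H lam f = f := by
  classical
  ext x
  rw [inducedProj_apply]
  have : ∀ h : H, ((lam h)⁻¹ : ℂˣ) * f (h * x) = f x := fun h => by
    rw [hf h x, Units.inv_mul_cancel_left]
  rw [Finset.sum_congr rfl fun h _ => this h, Finset.sum_const, Finset.card_univ,
    ← Nat.card_eq_fintype_card, nsmul_eq_mul,
    inv_mul_cancel_left₀ (Nat.cast_ne_zero.2 Nat.card_pos.ne')]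

/-- An operator with image in a subspace has the same trace as its restriction there. So the trace
of `g` on the induced space is that of projection followed by translation on all functions, read off
in the basis of delta functions. -/
theorem inducedChar_eq_character (H : Subgroup G) (lam : H →* ℂˣ) :
    inducedChar H lam = (inducedSubrep H lam).toRepresentation.character := by
  classical
  ext g
  set T := rightTranslation G g ∘ₗ inducedProj H lam with hT
  have hmem : ∀ f, T f ∈ (inducedSubrep H lam).toSubmodule := fun f =>
    (inducedSubrep H lam).apply_mem_toSubmodule g (inducedProj_mem H lam f)
  have h1 : (inducedSubrep H lam).toRepresentation g = T.restrict fun f _ => hmem f := by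
    ext1 f
    refine Subtype.ext ?_
    change rightTranslation G g f = rightTranslation G g (inducedProj H lam f)
    rw [inducedProj_of_mem H lam f.2]
  rw [character, h1, LinearMap.trace_restrict_eq_of_forall_mem _ _ hmem,
    LinearMap.trace_eq_matrix_trace ℂ (Pi.basisFun ℂ G), Matrix.trace, inducedChar,
    finsum_eq_sum_of_fintype, Finset.mul_sum]
  -- The delta function at `y` contributes through `y g y⁻¹`, whereas the induction formula uses
  -- `x⁻¹ g x`; hence `y = x⁻¹`.
  refine Fintype.sum_equiv (Equiv.inv G) _ _ fun x => ?_
  have : ∀ y, LinearMap.toMatrix (Pi.basisFun ℂ G) (Pi.basisFun ℂ G) T y y =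
      (Nat.card H : ℂ)⁻¹ * ∑ h : H, ((lam h)⁻¹ : ℂˣ) * Pi.single (M := fun _ => ℂ) y 1 (h * (y * g)) :=
    fun y => by
      rw [LinearMap.toMatrix_apply, Pi.basisFun_apply, Pi.basisFun_repr]
      rfl
  rw [Matrix.diag_apply, this]
  congr 1
  simp only [Equiv.inv_apply, Pi.single_apply]
  split_ifs with h
  · rw [Finset.sum_eq_single ⟨x⁻¹ * g * x, h⟩⁻¹]
    · simp [mul_assoc]
    · intro k _ hk
      rw [if_neg, mul_zero]
      intro h'
      refine hk (Subtype.ext ?_)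
      simp only [InvMemClass.coe_inv]
      rw [eq_mul_inv_of_mul_eq h']
      group
    · simp
  · refine (Finset.sum_eq_zero fun k _ => ?_).symm
    rw [if_neg, mul_zero]
    intro h'
    refine h ?_
    have : x⁻¹ * g * x = (k : G)⁻¹ := by
      rw [eq_mul_inv_of_mul_eq h']
      group
    rw [this]
    exact H.inv_mem k.2

theorem isCharacter_inducedChar (H : Subgroup G) (lam : H →* ℂˣ) :
    IsCharacter (inducedChar H lam) := by
  rw [inducedChar_eq_character]
  exact isCharacter_character _

end CharacterTheory

end AndreChar

namespace AndreChar

/-! ### Unitriangular matrices and independence of their rows. -/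

section Matrices

open Matrix

variable {n : ℕ} {F : Type*} [Field F]

/-- The underlying matrix of an element of `U n F`. -/
abbrev mat (g : U n F) : Matrix (Fin n) (Fin n) F := g.1.1

theorem mat_injective : Function.Injective (mat : U n F → Matrix (Fin n) (Fin n) F) :=
  fun _ _ h => Subtype.ext (Units.ext h)

theorem mat_mul (g h : U n F) : mat (g * h) = mat g * mat h := rfl

theorem mat_one : mat (1 : U n F) = 1 := rfl

theorem mat_mul_mat_inv (g : U n F) : mat g * mat g⁻¹ = 1 := by
  rw [← mat_mul, mul_inv_cancel, mat_one]

theorem mat_inv_mul_mat (g : U n F) : mat g⁻¹ * mat g = 1 := by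
  rw [← mat_mul, inv_mul_cancel, mat_one]

theorem mat_apply_self (g : U n F) (i : Fin n) : mat g i i = 1 := g.2.1 i

theorem mat_apply_of_lt (g : U n F) {i j : Fin n} (h : j < i) : mat g i j = 0 := g.2.2 i j h

/-- The element of `U n F` given by an upper unitriangular matrix. -/
noncomputable def ofMatrix (M : Matrix (Fin n) (Fin n) F) (h1 : ∀ i, M i i = 1)
    (h0 : ∀ i j, j < i → M i j = 0) : U n F :=
  ⟨GeneralLinearGroup.mkOfDetNeZero M (by
    rw [det_of_isUpperTriangular fun i j h => h0 i j h]; simp [h1]), h1, h0⟩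

theorem mat_ofMatrix (M : Matrix (Fin n) (Fin n) F) (h1 : ∀ i, M i i = 1)
    (h0 : ∀ i j, j < i → M i j = 0) : mat (ofMatrix M h1 h0) = M := rfl

variable (n F) in
/-- The space of strictly upper triangular matrices. -/
def strictUpper : Submodule F (Matrix (Fin n) (Fin n) F) where
  carrier := {m | ∀ i j, j ≤ i → m i j = 0}
  add_mem' := fun ha hb i j h => by simp [ha i j h, hb i j h]
  zero_mem' := fun _ _ _ => rfl
  smul_mem' := fun c m hm i j h => by simp [hm i j h]

theorem single_mem_strictUpper {i j : Fin n} (h : i < j) (c : F) :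
    Matrix.single i j c ∈ strictUpper n F := by
  intro k l hlk
  rw [Matrix.single_apply, if_neg]
  rintro ⟨rfl, rfl⟩
  exact hlk.not_gt h

theorem mat_sub_one_mem (g : U n F) : mat g - 1 ∈ strictUpper n F := by
  intro i j h
  rcases h.eq_or_lt with rfl | h
  · simp [mat_apply_self]
  · simp [mat_apply_of_lt g h, Matrix.one_apply_ne h.ne']

theorem mul_mem_strictUpper_left (g : U n F) {m : Matrix (Fin n) (Fin n) F}
    (hm : m ∈ strictUpper n F) : mat g * m ∈ strictUpper n F := by
  intro i j h
  rw [Matrix.mul_apply]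
  refine Finset.sum_eq_zero fun k _ => ?_
  rcases lt_or_ge k i with hk | hk
  · rw [mat_apply_of_lt g hk, zero_mul]
  · rw [hm k j (h.trans hk), mul_zero]

theorem mul_mem_strictUpper_right (g : U n F) {m : Matrix (Fin n) (Fin n) F}
    (hm : m ∈ strictUpper n F) : m * mat g ∈ strictUpper n F := by
  intro i j h
  rw [Matrix.mul_apply]
  refine Finset.sum_eq_zero fun k _ => ?_
  rcases lt_or_ge i k with hk | hk
  · rw [mat_apply_of_lt g (h.trans_lt hk), mul_zero]
  · rw [hm i k hk, zero_mul]

/-- The bijection `g ↦ g - 1` of `U n F` with the strictly upper triangular matrices. -/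
noncomputable def subOneEquiv : U n F ≃ strictUpper n F where
  toFun g := ⟨mat g - 1, mat_sub_one_mem g⟩
  invFun m := ofMatrix (1 + m.1) (fun i => by simp [m.2 i i le_rfl])
    fun i j h => by simp [m.2 i j h.le, Matrix.one_apply_ne h.ne']
  left_inv g := mat_injective (by rw [mat_ofMatrix]; simp)
  right_inv m := Subtype.ext (by simp [mat_ofMatrix])

/-- The element of `U n F` that agrees with `y` on row `r` and with `x` on the other rows. -/
noncomputable def replaceRow (r : Fin n) (x y : U n F) : U n F :=
  ofMatrix (fun i => if i = r then mat y i else mat x i)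
    (fun i => by split_ifs <;> exact mat_apply_self _ i)
    (fun i j h => by split_ifs <;> exact mat_apply_of_lt _ h)

theorem mat_replaceRow_self (r : Fin n) (x y : U n F) :
    mat (replaceRow r x y) r = mat y r := if_pos rfl

theorem mat_replaceRow_of_ne {r i : Fin n} (x y : U n F) (h : i ≠ r) :
    mat (replaceRow r x y) i = mat x i := if_neg h

theorem replaceRow_replaceRow (r : Fin n) (x y : U n F) :
    replaceRow r (replaceRow r x y) (replaceRow r y x) = x := by
  refine mat_injective (funext fun i => ?_)
  by_cases h : i = r
  · subst h; simp only [mat_replaceRow_self]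
  · simp only [mat_replaceRow_of_ne _ _ h]

variable [Fintype (U n F)]

/-- Functions of different rows are independent for the uniform distribution on `U n F`. -/
theorem card_mul_sum_mul_eq (r : Fin n) (f f' : U n F → ℂ)
    (hf : ∀ x y, mat x r = mat y r → f x = f y)
    (hf' : ∀ x y, (∀ i, i ≠ r → mat x i = mat y i) → f' x = f' y) :
    Fintype.card (U n F) * ∑ x, f x * f' x = (∑ x, f x) * ∑ x, f' x := by
  have h1 : ∑ p : U n F × U n F, f p.1 * f' p.2 = (∑ x, f x) * ∑ x, f' x := by
    rw [Fintype.sum_prod_type, Finset.sum_mul_sum]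
  -- Exchanging row `r` between two matrices is an involution of `U × U`. It turns `f x * f' y` into
  -- `f y * f' y`, and the free variable `x` yields the factor `|U|`.
  let e : U n F × U n F ≃ U n F × U n F :=
    { toFun := fun p => (replaceRow r p.1 p.2, replaceRow r p.2 p.1)
      invFun := fun p => (replaceRow r p.1 p.2, replaceRow r p.2 p.1)
      left_inv := fun p => Prod.ext (replaceRow_replaceRow r _ _) (replaceRow_replaceRow r _ _)
      right_inv := fun p => Prod.ext (replaceRow_replaceRow r _ _) (replaceRow_replaceRow r _ _) }
  rw [← h1, ← e.sum_comp, Fintype.sum_prod_type, Finset.sum_comm]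
  have h2 : ∀ x y : U n F, f (e (x, y)).1 * f' (e (x, y)).2 = f y * f' y := fun x y => by
    rw [hf (e (x, y)).1 y (mat_replaceRow_self r x y),
      hf' (e (x, y)).2 y fun i hi => mat_replaceRow_of_ne _ _ hi]
  simp only [h2, Finset.sum_const, Finset.card_univ, nsmul_eq_mul, Finset.mul_sum]

/-- The mean of a product over distinct rows is the product of the means. Denominators are cleared
with a spare `|U|` on the left, so that the empty product is covered. -/
theorem prod_sum_eq_card_pow_mul {ι : Type*} [DecidableEq ι] (s : Finset ι) (r : ι → Fin n)
    (hr : Set.InjOn r s) (f : ι → U n F → ℂ)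
    (hf : ∀ i ∈ s, ∀ x y, mat x (r i) = mat y (r i) → f i x = f i y) :
    Fintype.card (U n F) * ∏ i ∈ s, ∑ x, f i x =
      (Fintype.card (U n F) : ℂ) ^ s.card * ∑ x, ∏ i ∈ s, f i x := by
  induction s using Finset.induction_on with
  | empty => simp
  | insert a s ha ih =>
    have hi := ih (hr.mono (by simp)) fun i hi => hf i (Finset.mem_insert_of_mem hi)
    rw [Finset.prod_insert ha, mul_left_comm, hi, Finset.card_insert_of_notMem ha, pow_succ,
      mul_assoc, mul_left_comm, ← card_mul_sum_mul_eq (r a) (f a) _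
        (hf a (Finset.mem_insert_self a s))]
    · simp only [Finset.prod_insert ha]
    · intro x y hxy
      refine Finset.prod_congr rfl fun i hi => hf i (Finset.mem_insert_of_mem hi) x y
        (hxy _ fun h => ha ?_)
      rwa [← hr (Finset.mem_insert_of_mem hi) (Finset.mem_insert_self a s) h]

end Matrices

/-! ### Base groups and their linear characters. -/

section RootSubgroups

open Matrix

variable {n : ℕ} {F : Type*} [Field F]

theorem PosRoot.row_lt_col (α : PosRoot n) : α.row < α.col := α.2

theorem mat_rootElt (α : PosRoot n) (c : F) : mat (rootElt α c) = transvection α.row α.col c := rfl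

theorem mat_rootElt_apply (α : PosRoot n) (c : F) {i j : Fin n} (h : i < j) :
    mat (rootElt α c) i j = if i = α.row ∧ j = α.col then c else 0 := by
  rw [mat_rootElt, transvection, Matrix.add_apply, Matrix.one_apply_ne h.ne, zero_add,
    Matrix.single_apply]
  simp only [eq_comm]

theorem rootElt_mem (α : PosRoot n) (c : F) : rootElt α c ∈ rootSubgroup F α := ⟨c, rfl⟩

theorem rootElt_mul_rootElt (α : PosRoot n) (c d : F) :
    rootElt α c * rootElt α d = rootElt α (c + d) :=
  mat_injective (transvection_mul_transvection_same _ _ α.2.ne c d)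

theorem rootElt_zero (α : PosRoot n) : rootElt α (0 : F) = 1 :=
  mat_injective (transvection_zero _ _)

open Classical in
/-- The nonzero positions above the diagonal of an element of `U n F`. -/
noncomputable def rootSupport (g : U n F) : Finset (PosRoot n) :=
  {α | mat g α.row α.col ≠ 0}

theorem mem_rootSupport {g : U n F} {α : PosRoot n} :
    α ∈ rootSupport g ↔ mat g α.row α.col ≠ 0 := by simp [rootSupport]

/-- An element of `U n F` lies in the subgroup generated by the root subgroups of its support. -/
theorem mem_iSup_rootSubgroup (S : Set (PosRoot n)) (g : U n F)
    (h : ∀ α ∈ rootSupport g, α ∈ S) : g ∈ ⨆ β ∈ S, rootSubgroup F β := by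
  induction hd : (rootSupport g).card using Nat.strong_induction_on generalizing g with
  | _ d ih =>
  subst hd
  rcases (rootSupport g).eq_empty_or_nonempty with h0 | h0
  · have : g = 1 := by
      refine mat_injective (Matrix.ext fun i j => ?_)
      rw [mat_one]
      rcases lt_trichotomy i j with hij | rfl | hij
      · have : (⟨(i, j), hij⟩ : PosRoot n) ∉ rootSupport g := by simp [h0]
        rw [mem_rootSupport, not_not] at this
        rw [Matrix.one_apply_ne hij.ne]
        exact this
      · rw [mat_apply_self, Matrix.one_apply_eq]
      · rw [mat_apply_of_lt g hij, Matrix.one_apply_ne hij.ne']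
    rw [this]
    exact one_mem _
  -- For a support root in the lowest possible row, row `α.col` is zero off the diagonal, so left
  -- multiplication by a root element clears the entry at `α` and changes no other.
  obtain ⟨α, hα, hmax⟩ := (rootSupport g).exists_max_image (fun α => α.row) h0
  have hcol : ∀ j, j ≠ α.col → mat g α.col j = 0 := by
    intro j hj
    rcases lt_or_gt_of_ne hj with hj | hj
    · exact mat_apply_of_lt g hj
    · by_contra hne
      exact (hmax ⟨(α.col, j), hj⟩ (mem_rootSupport.2 hne)).not_gt α.2
  set g' := rootElt α (-mat g α.row α.col) * g with hg'
  have hg'_apply : ∀ i j, mat g' i j = if i = α.row ∧ j = α.col then 0 else mat g i j := by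
    intro i j
    rw [hg', mat_mul, mat_rootElt]
    by_cases hi : i = α.row
    · subst hi
      rw [transvection_mul_apply_same]
      by_cases hj : j = α.col
      · subst hj
        simp [mat_apply_self]
      · simp [hj, hcol j hj]
    · rw [transvection_mul_apply_of_ne _ _ _ _ hi]
      simp [hi]
  have hsub : ∀ β ∈ rootSupport g', β ∈ rootSupport g ∧ β ≠ α := by
    intro β hβ
    rw [mem_rootSupport, hg'_apply] at hβ
    split_ifs at hβ with hc
    · exact absurd rfl hβ
    · exact ⟨mem_rootSupport.2 hβ, by rintro rfl; exact hc ⟨rfl, rfl⟩⟩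
  have hlt : (rootSupport g').card < (rootSupport g).card :=
    Finset.card_lt_card (Finset.ssubset_iff_subset_ne.2 ⟨fun β hβ => (hsub β hβ).1, fun he =>
      (hsub α (he ▸ hα)).2 rfl⟩)
  have hmem := ih _ hlt g' (fun β hβ => h β (hsub β hβ).1) rfl
  have hroot : rootElt α (-mat g α.row α.col) ∈ ⨆ β ∈ S, rootSubgroup F β :=
    Subgroup.mem_iSup_of_mem α (Subgroup.mem_iSup_of_mem (h α hα) (rootElt_mem α _))
  exact (Subgroup.mul_mem_cancel_left _ hroot).1 hmem

/-- The elements of `U n F` whose entries on the arm of `α` vanish. -/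
def armFree (F : Type*) [Field F] (α : PosRoot n) : Subgroup (U n F) where
  carrier := {g | ∀ l, α.row < l → l < α.col → mat g α.row l = 0}
  one_mem' := fun l h _ => Matrix.one_apply_ne h.ne
  mul_mem' := by
    intro g h hg hh l h1 h2
    rw [mat_mul, Matrix.mul_apply]
    refine Finset.sum_eq_zero fun k _ => ?_
    rcases lt_trichotomy k α.row with hk | rfl | hk
    · rw [mat_apply_of_lt g hk, zero_mul]
    · rw [hh l h1 h2, mul_zero]
    · rcases lt_or_ge k α.col with hk' | hk'
      · rw [hg k hk hk', zero_mul]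
      · rw [mat_apply_of_lt h (h2.trans_le hk'), mul_zero]
  inv_mem' := by
    intro g hg l h1 h2
    have h : (mat g * mat g⁻¹) α.row l = 0 := by
      rw [mat_mul_mat_inv, Matrix.one_apply_ne h1.ne]
    rw [Matrix.mul_apply, Finset.sum_eq_single α.row, mat_apply_self, one_mul] at h
    · exact h
    · intro k _ hk
      rcases lt_or_gt_of_ne hk with hk | hk
      · rw [mat_apply_of_lt g hk, zero_mul]
      · rcases lt_or_ge k α.col with hk' | hk'
        · rw [hg k hk hk', zero_mul]
        · rw [mat_apply_of_lt g⁻¹ (h2.trans_le hk'), mul_zero]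
    · simp

theorem baseGroup_eq_armFree (α : PosRoot n) : baseGroup F α = armFree F α := by
  refine le_antisymm (iSup₂_le fun β hβ => ?_) fun g hg => mem_iSup_rootSubgroup _ _ fun β hβ => ?_
  · rintro _ ⟨c, rfl⟩ l h1 h2
    rw [mat_rootElt_apply _ _ h1, if_neg]
    rintro ⟨hr, hc⟩
    exact hβ ⟨hr.symm, hc ▸ h2⟩
  · rintro ⟨hr, hc⟩
    refine mem_rootSupport.1 hβ ?_
    rw [hr]
    exact hg _ (hr ▸ β.2) hc

theorem mem_baseGroup {α : PosRoot n} {g : U n F} :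
    g ∈ baseGroup F α ↔ ∀ l, α.row < l → l < α.col → mat g α.row l = 0 := by
  rw [baseGroup_eq_armFree]; rfl

theorem rootElt_self_mem_baseGroup (α : PosRoot n) (c : F) : rootElt α c ∈ baseGroup F α :=
  Subgroup.mem_iSup_of_mem α (Subgroup.mem_iSup_of_mem (fun h => h.2.false) (rootElt_mem α c))

/-- The cross terms `g_{ak} h_{kb}`, `a < k < b`, contain arm entries of `g`, which vanish. This
additivity makes `entryChar` a homomorphism. -/
theorem mat_mul_apply_of_mem_baseGroup {α : PosRoot n} {g : U n F} (hg : g ∈ baseGroup F α)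
    (h : U n F) : mat (g * h) α.row α.col = mat g α.row α.col + mat h α.row α.col := by
  rw [mem_baseGroup] at hg
  have hα : α.row < α.col := α.2
  rw [mat_mul, Matrix.mul_apply, Finset.sum_eq_add α.row α.col hα.ne, mat_apply_self,
    mat_apply_self, one_mul, mul_one, add_comm]
  · rintro k - ⟨h1, h2⟩
    rcases lt_or_gt_of_ne h1 with hk | hk
    · rw [mat_apply_of_lt g hk, zero_mul]
    · rcases lt_or_gt_of_ne h2 with hk' | hk'
      · rw [hg k hk hk', zero_mul]
      · rw [mat_apply_of_lt h hk', mul_zero]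
  · simp
  · simp

/-- The linear character `v ↦ θ (c * v_α)` of `V_α`. -/
def entryChar (θ : AddChar F ℂ) (α : PosRoot n) (c : F) : baseGroup F α →* ℂˣ :=
  MonoidHom.toHomUnits
    { toFun := fun v => θ (c * mat v.1 α.row α.col)
      map_one' := by
        rw [OneMemClass.coe_one, mat_one, Matrix.one_apply_ne α.row_lt_col.ne, mul_zero,
          AddChar.map_zero_eq_one]
      map_mul' := fun v w => by
        rw [Subgroup.coe_mul, mat_mul_apply_of_mem_baseGroup v.2, mul_add, AddChar.map_add_eq_mul] }

theorem entryChar_apply (θ : AddChar F ℂ) (α : PosRoot n) (c : F) (v : baseGroup F α) :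
    ((entryChar θ α c v : ℂˣ) : ℂ) = θ (c * mat v.1 α.row α.col) := rfl

theorem mat_rootElt_apply_self (α : PosRoot n) (c : F) :
    mat (rootElt α c) α.row α.col = c := by
  rw [mat_rootElt_apply _ _ α.row_lt_col]; simp

theorem mat_rootElt_apply_of_ne {α β : PosRoot n} (h : β ≠ α) (c : F) :
    mat (rootElt β c) α.row α.col = 0 := by
  rw [mat_rootElt_apply _ _ α.row_lt_col, if_neg]
  rintro ⟨h1, h2⟩
  exact h (Subtype.ext (Prod.ext h1.symm h2.symm))

theorem entryChar_mem_baseLinChars {θ : AddChar F ℂ} (hθ : θ.IsPrimitive) (α : PosRoot n) {c : F}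
    (hc : c ≠ 0) : entryChar θ α c ∈ baseLinChars F α := by
  refine ⟨?_, ?_⟩
  · obtain ⟨t, ht⟩ := (AddChar.ne_one_iff).1 (hθ hc)
    refine ⟨⟨rootElt α t, rootElt_self_mem_baseGroup α t⟩, rootElt_mem α t, fun h => ht ?_⟩
    have := congrArg Units.val h
    rwa [entryChar_apply, mat_rootElt_apply_self] at this
  · rintro β hβ - ⟨_, hv⟩ ⟨t, rfl⟩
    refine Units.ext ?_
    rw [entryChar_apply, mat_rootElt_apply_of_ne hβ, mul_zero, AddChar.map_zero_eq_one,
      Units.val_one]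

/-- Self-duality of `F`: the map `c ↦ θ (c ·)` is injective between finite sets of equal size. -/
theorem exists_mulShift_eq [Finite F] {θ : AddChar F ℂ} (hθ : θ.IsPrimitive) (ψ : AddChar F ℂ) :
    ∃ c, θ.mulShift c = ψ := by
  have := Fintype.ofFinite F
  have h := (Fintype.bijective_iff_injective_and_card θ.mulShift).2
    ⟨AddChar.to_mulShift_inj_of_isPrimitive hθ, AddChar.card_eq.symm⟩
  exact h.2 ψ

theorem exists_eq_entryChar [Finite F] {θ : AddChar F ℂ} (hθ : θ.IsPrimitive) {α : PosRoot n}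
    {lam : baseGroup F α →* ℂˣ} (hlam : lam ∈ baseLinChars F α) :
    ∃ c, c ≠ 0 ∧ lam = entryChar θ α c := by
  let x : F → baseGroup F α := fun t => ⟨rootElt α t, rootElt_self_mem_baseGroup α t⟩
  let ψ : AddChar F ℂ :=
    { toFun := fun t => (lam (x t) : ℂˣ)
      map_zero_eq_one' := by
        have : x 0 = 1 := Subtype.ext (rootElt_zero α)
        rw [this, map_one, Units.val_one]
      map_add_eq_mul' := fun s t => by
        have : x (s + t) = x s * x t := Subtype.ext (rootElt_mul_rootElt α s t).symm
        rw [this, map_mul, Units.val_mul] }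
  obtain ⟨c, hc⟩ := exists_mulShift_eq hθ ψ
  have hroot : ∀ t, lam (x t) = entryChar θ α c (x t) := fun t => Units.ext <| by
    rw [entryChar_apply, mat_rootElt_apply_self]
    exact (DFunLike.congr_fun hc t).symm
  refine ⟨c, ?_, ?_⟩
  · rintro rfl
    obtain ⟨⟨_, hv⟩, ⟨t, rfl⟩, hne⟩ := hlam.1
    refine hne ((hroot t).trans (Units.ext ?_))
    rw [entryChar_apply, zero_mul, AddChar.map_zero_eq_one, Units.val_one]
  -- The locus where the two characters agree contains every generating root subgroup, hence is all
  -- of `V_α`.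
  · have hle : baseGroup F α ≤ (MonoidHom.eqLocus lam (entryChar θ α c)).map
        (baseGroup F α).subtype := by
      refine iSup₂_le fun β hβ => ?_
      have hβ' : rootSubgroup F β ≤ baseGroup F α := le_iSup₂_of_le β hβ le_rfl
      rintro _ ⟨t, rfl⟩
      refine ⟨⟨rootElt β t, hβ' (rootElt_mem β t)⟩, ?_, rfl⟩
      by_cases h : β = α
      · subst h
        exact hroot t
      · refine (hlam.2 β h hβ' _ (rootElt_mem β t)).trans (Units.ext ?_)
        rw [entryChar_apply, mat_rootElt_apply_of_ne h, mul_zero, AddChar.map_zero_eq_one,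
          Units.val_one]
    ext v
    obtain ⟨w, hw, hwv⟩ := hle v.2
    obtain rfl : w = v := Subtype.ext hwv
    exact congrArg Units.val hw

end RootSubgroups

end AndreChar

namespace AndreChar

/-! ### Linear forms, additive characters and elementary characters. -/

section Duality

open Matrix

variable {n : ℕ} {F : Type*} [Field F]

/-- The linear form `m ↦ ∑ i j, A i j * m i j` on matrices. -/
def dot (A : Matrix (Fin n) (Fin n) F) : Matrix (Fin n) (Fin n) F →ₗ[F] F :=
  Matrix.traceLinearMap (Fin n) F F ∘ₗ LinearMap.mulLeft F Aᵀ

theorem dot_eq_trace (A m : Matrix (Fin n) (Fin n) F) : dot A m = (Aᵀ * m).trace := rfl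

theorem dot_eq_sum (A m : Matrix (Fin n) (Fin n) F) : dot A m = ∑ i, ∑ j, A i j * m i j := by
  rw [dot_eq_trace, Matrix.trace, Finset.sum_comm]
  simp [Matrix.mul_apply]

theorem dot_single (A : Matrix (Fin n) (Fin n) F) (i j : Fin n) (c : F) :
    dot A (Matrix.single i j c) = A i j * c := by
  rw [dot_eq_trace, Matrix.trace_mul_single, Matrix.transpose_apply, op_smul_eq_mul]

theorem dot_comm (A m : Matrix (Fin n) (Fin n) F) : dot A m = dot m A := by
  simp only [dot_eq_sum, mul_comm]

theorem dot_mul_mul (A x m y : Matrix (Fin n) (Fin n) F) :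
    dot A (x * m * y) = dot (xᵀ * A * yᵀ) m := by
  rw [dot_eq_trace, dot_eq_trace, ← Matrix.mul_assoc, Matrix.trace_mul_comm, transpose_mul,
    transpose_mul, transpose_transpose, transpose_transpose]
  simp only [Matrix.mul_assoc]

theorem addChar_map_sum {ι : Type*} (θ : AddChar F ℂ) (s : Finset ι) (f : ι → F) :
    θ (∑ i ∈ s, f i) = ∏ i ∈ s, θ (f i) := by
  classical
  induction s using Finset.induction_on with
  | empty => simp
  | insert a s ha ih => rw [Finset.sum_insert ha, Finset.prod_insert ha, AddChar.map_add_eq_mul, ih]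

theorem sum_addChar_comp_eq_ite {V : Type*} [AddCommGroup V] [Module F V] [Fintype V]
    {θ : AddChar F ℂ} (hθ : θ ≠ 1) (l : V →ₗ[F] F) [Decidable (l = 0)] :
    ∑ v, θ (l v) = if l = 0 then (Fintype.card V : ℂ) else 0 := by
  split_ifs with h
  · subst h; simp
  · obtain ⟨v, hv⟩ : ∃ v, l v ≠ 0 := by
      by_contra! h'
      exact h (LinearMap.ext h')
    obtain ⟨t, ht⟩ := AddChar.ne_one_iff.1 hθ
    have hne : θ.compAddMonoidHom l.toAddMonoidHom ≠ 1 :=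
      AddChar.ne_one_iff.2 ⟨(t / l v) • v, by simpa [hv] using ht⟩
    exact AddChar.sum_eq_zero_of_ne_one hne

/-- Right multiplication by `x` adds to each column multiples of columns to its left, and row
`α.row` of `m` vanishes to the left of `α.col`. -/
theorem arm_entries_mul {α : PosRoot n} {m : Matrix (Fin n) (Fin n) F}
    (hm : m ∈ strictUpper n F) (h : ∀ l, α.row < l → l < α.col → m α.row l = 0) (x : U n F) :
    (∀ l, α.row < l → l < α.col → (m * mat x) α.row l = 0) ∧
      (m * mat x) α.row α.col = m α.row α.col := by
  have h0 : ∀ l, l < α.col → m α.row l = 0 := fun l hl =>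
    (le_or_gt l α.row).elim (hm _ _) fun h' => h l h' hl
  constructor
  · intro l _ hl
    rw [Matrix.mul_apply]
    refine Finset.sum_eq_zero fun k _ => ?_
    rcases lt_or_ge k α.col with hk | hk
    · rw [h0 k hk, zero_mul]
    · rw [mat_apply_of_lt x (hl.trans_le hk), mul_zero]
  · rw [Matrix.mul_apply, Finset.sum_eq_single α.col, mat_apply_self, mul_one]
    · intro k _ hk
      rcases lt_or_gt_of_ne hk with hk | hk
      · rw [h0 k hk, zero_mul]
      · rw [mat_apply_of_lt x hk, mul_zero]
    · simp

variable (θ : AddChar F ℂ)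

open Classical in
/-- The contribution of a matrix to the elementary character at `α`. -/
noncomputable def armTerm (α : PosRoot n) (c : F) (m : Matrix (Fin n) (Fin n) F) : ℂ :=
  if ∀ l, α.row < l → l < α.col → m α.row l = 0 then θ (c * m α.row α.col) else 0

theorem armTerm_mul (α : PosRoot n) (c : F) {m : Matrix (Fin n) (Fin n) F}
    (hm : m ∈ strictUpper n F) (x : U n F) :
    armTerm θ α c (m * mat x) = armTerm θ α c m := by
  unfold armTerm
  by_cases h : ∀ l, α.row < l → l < α.col → m α.row l = 0
  · rw [if_pos h, if_pos (arm_entries_mul hm h x).1, (arm_entries_mul hm h x).2]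
  · rw [if_neg h, if_neg]
    intro h'
    have := (arm_entries_mul (mul_mem_strictUpper_right x hm) h' x⁻¹).1
    rw [Matrix.mul_assoc, mat_mul_mat_inv, Matrix.mul_one] at this
    exact h this

variable [Fintype (U n F)]

/-- `U` is the affine space `1 + strictUpper`, so this is a sum of an additive character over a
vector space, times `θ (l 1)`. -/
theorem sum_unitriangular_eq {θ : AddChar F ℂ} (hθ : θ ≠ 1) (l : Matrix (Fin n) (Fin n) F →ₗ[F] F)
    [Decidable (∀ z ∈ strictUpper n F, l z = 0)] :
    ∑ y : U n F, θ (l (mat y)) =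
      if ∀ z ∈ strictUpper n F, l z = 0 then Fintype.card (U n F) * θ (l 1) else 0 := by
  classical
  let _ : Fintype (strictUpper n F) := Fintype.ofEquiv _ subOneEquiv
  have h1 : ∀ y : U n F, θ (l (mat y)) =
      θ (l 1) * θ ((l ∘ₗ (strictUpper n F).subtype) (subOneEquiv y)) := fun y => by
    rw [← AddChar.map_add_eq_mul]
    change _ = θ (l 1 + l (mat y - 1))
    rw [← map_add, add_sub_cancel]
  rw [Finset.sum_congr rfl fun y _ => h1 y, ← Finset.mul_sum,
    subOneEquiv.sum_comp fun z => θ ((l ∘ₗ (strictUpper n F).subtype) z),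
    sum_addChar_comp_eq_ite hθ, ← Fintype.card_congr (subOneEquiv (n := n) (F := F))]
  have h2 : l ∘ₗ (strictUpper n F).subtype = 0 ↔ ∀ z ∈ strictUpper n F, l z = 0 :=
    ⟨fun h z hz => LinearMap.congr_fun h ⟨z, hz⟩, fun h => LinearMap.ext fun z => h z.1 z.2⟩
  simp only [h2]
  split_ifs <;> ring

/-- The sum of `θ ∘ dot A` over the two-sided `U`-orbit (with multiplicities) of `g - 1`. -/
def superSum (A : Matrix (Fin n) (Fin n) F) (g : U n F) : ℂ :=
  ∑ x : U n F, ∑ y : U n F, θ (dot A (mat x * (mat g - 1) * mat y))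

/-- Since `x⁻¹ g x - 1 = x⁻¹ (g - 1) x` and `armTerm` ignores the right factor, only left
multiplication remains; the summand then sees just row `α.row` of `x`. -/
theorem inducedChar_entryChar (α : PosRoot n) (c : F) (g : U n F) :
    inducedChar (baseGroup F α) (entryChar θ α c) g =
      (Nat.card (baseGroup F α) : ℂ)⁻¹ *
        ∑ x : U n F, armTerm θ α c (mat x * (mat g - 1)) := by
  classical
  rw [inducedChar, finsum_eq_sum_of_fintype]
  congr 1
  refine Fintype.sum_equiv (Equiv.inv _) _ _ fun x => ?_
  rw [Equiv.inv_apply]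
  have hm := mul_mem_strictUpper_left x⁻¹ (mat_sub_one_mem g)
  rw [← armTerm_mul θ α c hm x]
  have h1 : mat (x⁻¹ * g * x) = mat x⁻¹ * (mat g - 1) * mat x + 1 := by
    rw [mat_mul, mat_mul, Matrix.mul_sub, Matrix.sub_mul, Matrix.mul_one, mat_inv_mul_mat,
      sub_add_cancel]
  have h2 : ∀ l, α.row < l →
      mat (x⁻¹ * g * x) α.row l = (mat x⁻¹ * (mat g - 1) * mat x) α.row l := fun l hl => by
    rw [h1, Matrix.add_apply, Matrix.one_apply_ne hl.ne, add_zero]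
  have h3 : x⁻¹ * g * x ∈ baseGroup F α ↔ ∀ l, α.row < l → l < α.col →
      (mat x⁻¹ * (mat g - 1) * mat x) α.row l = 0 := by
    rw [mem_baseGroup]
    exact forall₂_congr fun l hl => by rw [h2 l hl]
  unfold armTerm
  by_cases h : x⁻¹ * g * x ∈ baseGroup F α
  · rw [dif_pos h, if_pos (h3.1 h), entryChar_apply, h2 _ α.row_lt_col]
  · rw [dif_neg h, if_neg fun h' => h (h3.2 h')]

end Duality

/-! ### Rook matrices and products of elementary characters. -/

section Rook

variable {n : ℕ} {F : Type*} [Field F]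

/-- A strictly upper triangular matrix with at most one nonzero entry in every row and every
column. -/
structure IsRook (A : Matrix (Fin n) (Fin n) F) : Prop where
  lt : ∀ {i j}, A i j ≠ 0 → i < j
  col_eq : ∀ {i j j'}, A i j ≠ 0 → A i j' ≠ 0 → j = j'
  row_eq : ∀ {i i' j}, A i j ≠ 0 → A i' j ≠ 0 → i = i'

open Classical in
/-- The positions above the diagonal where a matrix does not vanish. -/
noncomputable def rookRoots (A : Matrix (Fin n) (Fin n) F) : Finset (PosRoot n) := {α | A α.row α.col ≠ 0}

theorem mem_rookRoots {A : Matrix (Fin n) (Fin n) F} {α : PosRoot n} :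
    α ∈ rookRoots A ↔ A α.row α.col ≠ 0 := by simp [rookRoots]

theorem IsRook.dot_eq_sum {A : Matrix (Fin n) (Fin n) F} (hA : IsRook A)
    (m : Matrix (Fin n) (Fin n) F) :
    dot A m = ∑ α ∈ rookRoots A, A α.row α.col * m α.row α.col := by
  rw [AndreChar.dot_eq_sum, ← Finset.sum_product', eq_comm]
  refine Finset.sum_of_injOn Subtype.val Subtype.val_injective.injOn (by simp) ?_ fun _ _ => rfl
  rintro ⟨i, j⟩ - h
  by_contra hne
  have hij : A i j ≠ 0 := left_ne_zero_of_mul hne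
  exact h ⟨⟨(i, j), hA.lt hij⟩, Finset.mem_coe.2 (mem_rookRoots.2 hij), rfl⟩

theorem isRook_zero : IsRook (0 : Matrix (Fin n) (Fin n) F) :=
  ⟨fun h => absurd rfl h, fun h => absurd rfl h, fun h => absurd rfl h⟩

theorem IsRook.injOn_row {A : Matrix (Fin n) (Fin n) F} (hA : IsRook A) :
    Set.InjOn PosRoot.row (rookRoots A : Set (PosRoot n)) := by
  intro α hα β hβ h
  rw [Finset.mem_coe, mem_rookRoots] at hα hβ
  rw [← h] at hβ
  exact Subtype.ext (Prod.ext h (hA.col_eq hα hβ))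

theorem IsRook.dot_mul_single {A : Matrix (Fin n) (Fin n) F} (hA : IsRook A) {α : PosRoot n}
    (hα : α ∈ rookRoots A) (m : Matrix (Fin n) (Fin n) F) (l : Fin n) :
    dot A (m * Matrix.single l α.col 1) = A α.row α.col * m α.row l := by
  rw [hA.dot_eq_sum, Finset.sum_eq_single α]
  · simp
  · intro β hβ hne
    rw [mem_rookRoots] at hα hβ
    rw [Matrix.mul_single_apply_of_ne, mul_zero]
    intro h
    rw [h] at hβ
    exact hne (Subtype.ext (Prod.ext (hA.row_eq hβ hα) h))
  · exact fun h => absurd hα h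

variable [Fintype (U n F)] {θ : AddChar F ℂ}

/-- The sum over `y` vanishes unless `z ↦ dot A (m z)` is zero on strictly upper triangular `z`.
Testing on `e_{l, α.col}` with `l < α.col` shows that this means exactly that `m` is zero on the
arms of all roots of `A`. -/
theorem IsRook.card_mul_prod_armTerm (hθ : θ ≠ 1) {A : Matrix (Fin n) (Fin n) F} (hA : IsRook A)
    {m : Matrix (Fin n) (Fin n) F} (hm : m ∈ strictUpper n F) :
    Fintype.card (U n F) * ∏ α ∈ rookRoots A, armTerm θ α (A α.row α.col) m =
      ∑ y : U n F, θ (dot A (m * mat y)) := by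
  classical
  have key := sum_unitriangular_eq hθ (dot A ∘ₗ LinearMap.mulLeft F m)
  simp only [LinearMap.comp_apply, LinearMap.mulLeft_apply, Matrix.mul_one] at key
  rw [key]
  by_cases h : ∀ α ∈ rookRoots A, ∀ l, α.row < l → l < α.col → m α.row l = 0
  · rw [if_pos, hA.dot_eq_sum, addChar_map_sum]
    · congr 1
      exact Finset.prod_congr rfl fun α hα => if_pos (h α hα)
    · intro z hz
      rw [hA.dot_eq_sum]
      refine Finset.sum_eq_zero fun α hα => ?_
      rw [Matrix.mul_apply, Finset.sum_eq_zero, mul_zero]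
      intro k _
      rcases le_or_gt k α.row with hk | hk
      · rw [hm _ _ hk, zero_mul]
      · rcases lt_or_ge k α.col with hk' | hk'
        · rw [h α hα k hk hk', zero_mul]
        · rw [hz _ _ hk', mul_zero]
  · push Not at h
    obtain ⟨α, hα, l, h1, h2, h3⟩ := h
    rw [if_neg, Finset.prod_eq_zero hα, mul_zero]
    · exact if_neg fun h => h3 (h l h1 h2)
    · intro h
      have := h _ (single_mem_strictUpper h2 1)
      rw [hA.dot_mul_single hα] at this
      exact mul_ne_zero (mem_rookRoots.1 hα) h3 this

/-- The product of the elementary characters attached to a rook matrix is a multiple of the sum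
over the two-sided orbit. -/
theorem IsRook.prod_inducedChar (hθ : θ ≠ 1) {A : Matrix (Fin n) (Fin n) F} (hA : IsRook A) :
    ∃ K : ℂ, K ≠ 0 ∧ ∏ α ∈ rookRoots A, inducedChar (baseGroup F α)
      (entryChar θ α (A α.row α.col)) = K • superSum θ A := by
  classical
  have hU : (Fintype.card (U n F) : ℂ) ≠ 0 := Nat.cast_ne_zero.2 Fintype.card_ne_zero
  -- One factor `|U|` in the denominator comes from row independence, the other from the sum over
  -- `y` in `superSum`.
  refine ⟨(∏ α ∈ rookRoots A, (Nat.card (baseGroup F α) : ℂ)⁻¹) *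
    ((Fintype.card (U n F) : ℂ) ^ (rookRoots A).card / Fintype.card (U n F) ^ 2),
    mul_ne_zero (Finset.prod_ne_zero_iff.2 fun α _ =>
      inv_ne_zero (Nat.cast_ne_zero.2 Nat.card_pos.ne'))
      (div_ne_zero (pow_ne_zero _ hU) (pow_ne_zero _ hU)), ?_⟩
  ext g
  rw [Finset.prod_apply, Finset.prod_congr rfl fun α _ => inducedChar_entryChar θ α _ g,
    Finset.prod_mul_distrib, Pi.smul_apply, smul_eq_mul, mul_assoc]
  congr 1
  have h1 := prod_sum_eq_card_pow_mul (rookRoots A) PosRoot.row hA.injOn_row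
    (fun α x => armTerm θ α (A α.row α.col) (mat x * (mat g - 1))) fun α _ x y hxy => by
      have : ∀ l, (mat x * (mat g - 1)) α.row l = (mat y * (mat g - 1)) α.row l := fun l => by
        rw [Matrix.mul_apply, Matrix.mul_apply, hxy]
      simp only [armTerm, this]
  have h2 : superSum θ A g = Fintype.card (U n F) *
      ∑ x : U n F, ∏ α ∈ rookRoots A, armTerm θ α (A α.row α.col) (mat x * (mat g - 1)) := by
    rw [Finset.mul_sum]
    exact Finset.sum_congr rfl fun x _ => (hA.card_mul_prod_armTerm hθ
      (mul_mem_strictUpper_left x (mat_sub_one_mem g))).symm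
  rw [h2, ← mul_right_inj' hU, h1]
  field_simp

end Rook

end AndreChar

namespace AndreChar

/-! ### Two-sided orbits of linear forms: normal form and orthogonality. -/

section Orbits

open Matrix

variable {n : ℕ} {F : Type*} [Field F]

/-- The linear forms `dot A` and `dot B` on strictly upper triangular matrices lie in the same
orbit of `U × U`. -/
def OrbitRel (A B : Matrix (Fin n) (Fin n) F) : Prop :=
  ∃ x y : U n F, ∀ z ∈ strictUpper n F, dot A (mat x * z * mat y) = dot B z

theorem OrbitRel.trans {A B C : Matrix (Fin n) (Fin n) F} (h : OrbitRel A B) (h' : OrbitRel B C) :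
    OrbitRel A C := by
  obtain ⟨x, y, h⟩ := h
  obtain ⟨x', y', h'⟩ := h'
  refine ⟨x * x', y' * y, fun z hz => ?_⟩
  rw [← h' z hz, ← h _ (mul_mem_strictUpper_right y' (mul_mem_strictUpper_left x' hz)), mat_mul,
    mat_mul]
  simp only [Matrix.mul_assoc]

theorem dot_congr {A B : Matrix (Fin n) (Fin n) F} (h : ∀ i j, i < j → A i j = B i j)
    {z : Matrix (Fin n) (Fin n) F} (hz : z ∈ strictUpper n F) : dot A z = dot B z := by
  rw [dot_eq_sum, dot_eq_sum]
  refine Finset.sum_congr rfl fun i _ => Finset.sum_congr rfl fun j _ => ?_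
  rcases le_or_gt j i with hij | hij
  · rw [hz i j hij, mul_zero, mul_zero]
  · rw [h i j hij]

theorem orbitRel_of_forall_eq {A B : Matrix (Fin n) (Fin n) F} (x y : U n F)
    (h : ∀ i j, i < j → ((mat x)ᵀ * A * (mat y)ᵀ) i j = B i j) : OrbitRel A B :=
  ⟨x, y, fun z hz => by rw [dot_mul_mul, dot_congr h hz]⟩

/-- Moving `y` to the other side as `w = y⁻¹` gives `xᵀ A = B wᵀ` above the diagonal, with one
triangular factor on each side. -/
theorem OrbitRel.exists_sum_eq {A B : Matrix (Fin n) (Fin n) F} (h : OrbitRel A B) :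
    ∃ x w : U n F, ∀ k j, k < j →
      ∑ i, mat x i k * A i j = ∑ l, B k l * mat w j l := by
  obtain ⟨x, y, h⟩ := h
  refine ⟨x, y⁻¹, fun k j hkj => ?_⟩
  have h1 := h _ (mul_mem_strictUpper_right y⁻¹ (single_mem_strictUpper hkj 1))
  rw [← Matrix.mul_assoc, Matrix.mul_assoc, mat_inv_mul_mat, dot_mul_mul,
    ← Matrix.one_mul (Matrix.single k j (1 : F) * _), ← Matrix.mul_assoc 1, dot_mul_mul,
    dot_single, dot_single] at h1
  simp only [Matrix.transpose_one, Matrix.one_mul, mul_one] at h1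
  simpa [Matrix.mul_apply] using h1

/-- In `xᵀ A = B wᵀ`, an entry of `B` forces an entry of `A` in its column, no lower (`hAB`).
Working down the rows, an entry of `A` in row `i` forces some `B i l ≠ 0`, hence an entry of `A` in
column `l`. If that lay above row `i`, induction would give `B` two entries in column `l`; so it
lies in row `i`, and the entries coincide. -/
theorem IsRook.eq_of_orbitRel {A B : Matrix (Fin n) (Fin n) F} (hA : IsRook A) (hB : IsRook B)
    (h : OrbitRel A B) : A = B := by
  obtain ⟨x, w, h⟩ := h.exists_sum_eq
  have hl : ∀ {i j}, A i j ≠ 0 → ∀ k, ∑ i', mat x i' k * A i' j = mat x i k * A i j := by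
    intro i j hij k
    refine Finset.sum_eq_single i (fun i' _ hne => ?_) (by simp)
    by_contra hi'
    exact hne (hA.row_eq (right_ne_zero_of_mul hi') hij)
  have hr : ∀ {k l}, B k l ≠ 0 → ∀ j, ∑ l', B k l' * mat w j l' = B k l * mat w j l := by
    intro k l hkl j
    refine Finset.sum_eq_single l (fun l' _ hne => ?_) (by simp)
    by_contra hl'
    exact hne (hB.col_eq (left_ne_zero_of_mul hl') hkl)
  have hAB : ∀ {i l}, B i l ≠ 0 → ∃ i' ≤ i, A i' l ≠ 0 := by
    intro i l hil
    have h1 := h i l (hB.lt hil)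
    rw [hr hil, mat_apply_self, mul_one] at h1
    obtain ⟨i', -, hi'⟩ := Finset.exists_ne_zero_of_sum_ne_zero (h1 ▸ hil)
    refine ⟨i', ?_, right_ne_zero_of_mul hi'⟩
    by_contra! hlt
    exact left_ne_zero_of_mul hi' (mat_apply_of_lt x hlt)
  have key : ∀ i j, A i j ≠ 0 → B i j = A i j := by
    intro i
    induction i using WellFoundedLT.induction with
    | _ i ih =>
    intro j hij
    have h1 := h i j (hA.lt hij)
    rw [hl hij, mat_apply_self, one_mul] at h1
    obtain ⟨l, -, hl'⟩ := Finset.exists_ne_zero_of_sum_ne_zero (h1 ▸ hij)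
    have hil := left_ne_zero_of_mul hl'
    obtain ⟨i', hi', hi'l⟩ := hAB hil
    rcases hi'.lt_or_eq with hlt | rfl
    · have := ih i' hlt l hi'l
      exact absurd (hB.row_eq (this ▸ hi'l) hil) hlt.ne
    · obtain rfl := hA.col_eq hij hi'l
      rw [hr hil, mat_apply_self, mul_one] at h1
      exact h1.symm
  ext i j
  by_cases hij : A i j = 0
  · by_contra hne
    have hB' : B i j ≠ 0 := fun h0 => hne (hij.trans h0.symm)
    obtain ⟨i', -, hi'⟩ := hAB hB'
    have := hB.row_eq (key i' j hi' ▸ hi') hB'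
    exact hi' (this ▸ hij)
  · exact (key i j hij).symm

/-- One step of Gaussian elimination. -/
theorem orbitRel_eliminate (B : Matrix (Fin n) (Fin n) F) (r c : Fin n) (u w : Fin n → F)
    (hu : ∀ k, k ≤ r → u k = 0) (hw : ∀ k, c ≤ k → w k = 0) {D : Matrix (Fin n) (Fin n) F}
    (hD : ∀ i j, i < j → D i j = B i j + B i c * w j + u i * (B r j + B r c * w j)) :
    OrbitRel B D := by
  have hx0 : ∀ i j, (vecMulVec (Pi.single r 1) u : Matrix (Fin n) (Fin n) F) i j =
      if i = r then u j else 0 := fun i j => by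
    simp [vecMulVec_apply, Pi.single_apply]
  have hy0 : ∀ i j, (vecMulVec w (Pi.single c 1) : Matrix (Fin n) (Fin n) F) i j =
      if j = c then w i else 0 := fun i j => by
    simp [vecMulVec_apply, Pi.single_apply]
  -- On coefficients, `xᵀ` adds `u i` times row `r` to the rows `i` below it, and `yᵀ` adds `w j`
  -- times column `c` to the columns `j` on its left.
  let x : U n F := ofMatrix (1 + vecMulVec (Pi.single r 1) u)
    (fun i => by
      rw [Matrix.add_apply, hx0, Matrix.one_apply_eq, add_eq_left]
      split_ifs with h
      · exact hu _ h.le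
      · rfl)
    fun i j hij => by
      rw [Matrix.add_apply, hx0, Matrix.one_apply_ne hij.ne', zero_add]
      split_ifs with h
      · exact hu _ (h ▸ hij.le)
      · rfl
  let y : U n F := ofMatrix (1 + vecMulVec w (Pi.single c 1))
    (fun i => by
      rw [Matrix.add_apply, hy0, Matrix.one_apply_eq, add_eq_left]
      split_ifs with h
      · exact hw _ h.ge
      · rfl)
    fun i j hij => by
      rw [Matrix.add_apply, hy0, Matrix.one_apply_ne hij.ne', zero_add]
      split_ifs with h
      · exact hw _ (h ▸ hij.le)
      · rfl
  refine orbitRel_of_forall_eq x y fun i j hij => ?_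
  rw [hD i j hij, mat_ofMatrix, mat_ofMatrix, Matrix.transpose_add, Matrix.transpose_add,
    Matrix.transpose_one, transpose_vecMulVec, transpose_vecMulVec, Matrix.add_mul, Matrix.one_mul,
    Matrix.mul_add, Matrix.mul_one, vecMulVec_mul, mul_vecMulVec, single_one_vecMul,
    mulVec_single_one]
  simp [vecMulVec_apply]
  ring

/-- Rows are treated from the top. The pivot is the rightmost nonzero entry of the row; its row is
cleared to the left and its column downwards, the only directions `U × U` allows. Entries on or
below the diagonal are discarded, as the form does not see them. -/
theorem exists_orbitRel_partial_rook (B : Matrix (Fin n) (Fin n) F) (r : ℕ) (hr : r ≤ n) :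
    ∃ D : Matrix (Fin n) (Fin n) F, OrbitRel B D ∧ (∀ i j, D i j ≠ 0 → i < j) ∧
      ∀ i j, i.1 < r → D i j ≠ 0 →
        (∀ j', D i j' ≠ 0 → j' = j) ∧ ∀ i', D i' j ≠ 0 → i' = i := by
  induction r with
  | zero =>
    refine ⟨fun i j => if i < j then B i j else 0, orbitRel_of_forall_eq 1 1 fun i j hij => ?_,
      fun i j h => ?_, fun i j h => absurd h (Nat.not_lt_zero _)⟩
    · simp [mat_one, hij]
    · by_contra h'
      exact h (if_neg h')
  | succ r ih =>
    obtain ⟨D, hBD, hlt, hD⟩ := ih (Nat.le_of_succ_le hr)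
    let ρ : Fin n := ⟨r, hr⟩
    by_cases h0 : ∀ j, D ρ j = 0
    · refine ⟨D, hBD, hlt, fun i j hi hij => ?_⟩
      rcases (Nat.lt_succ_iff.1 hi).lt_or_eq with hi | hi
      · exact hD i j hi hij
      · obtain rfl : i = ρ := Fin.ext hi
        exact absurd (h0 j) hij
    classical
    push Not at h0
    obtain ⟨c, hc, hmax⟩ := Finset.exists_max_image (Finset.univ.filter fun j => D ρ j ≠ 0) id
      (by obtain ⟨j, hj⟩ := h0; exact ⟨j, by simpa using hj⟩)
    simp only [Finset.mem_filter, Finset.mem_univ, true_and, id] at hc hmax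
    -- An entry above the pivot would, by the invariant, already be alone in its column.
    have hDc : ∀ i, i < ρ → D i c = 0 := fun i hi => by
      by_contra h
      exact hi.ne ((hD i c hi h).2 ρ hc).symm
    have hDr : ∀ j, c < j → D ρ j = 0 := fun j hj => by
      by_contra h
      exact (hmax j h).not_gt hj
    let w : Fin n → F := fun j => if j < c then -D ρ j / D ρ c else 0
    let u : Fin n → F := fun i => if ρ < i then -D i c / D ρ c else 0
    have hw : ∀ j, D ρ j + D ρ c * w j = if j = c then D ρ c else 0 := by
      intro j
      rcases lt_trichotomy j c with h | rfl | h
      · simp only [w, if_pos h, if_neg h.ne]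
        field_simp
        ring
      · simp [w]
      · simp [w, h.not_gt, h.ne', hDr j h]
    let E : Matrix (Fin n) (Fin n) F := fun i j =>
      if i < j then D i j + D i c * w j + u i * (D ρ j + D ρ c * w j) else 0
    have hE : ∀ i j, i < j → E i j = D i j + D i c * w j + u i * (D ρ j + D ρ c * w j) :=
      fun i j h => if_pos h
    have hElt : ∀ i j, E i j ≠ 0 → i < j := fun i j h => by
      by_contra h'
      exact h (if_neg h')
    have hrow : ∀ j, E ρ j ≠ 0 → j = c := by
      intro j hj
      rw [hE _ _ (hElt _ _ hj), hw] at hj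
      by_contra h
      simp [h] at hj
    have hcol : ∀ i, E i c ≠ 0 → i = ρ := by
      intro i hi
      rw [hE _ _ (hElt _ _ hi), hw, if_pos rfl] at hi
      by_contra h
      refine hi ?_
      rcases lt_or_gt_of_ne h with h | h
      · simp [u, w, h.not_gt, hDc i h]
      · simp only [u, w, if_pos h, lt_irrefl, if_false]
        field_simp
        ring
    have hEc : ∀ i j, j ≠ c → E i j ≠ 0 → E i j = D i j + D i c * w j := by
      intro i j hj hij
      rw [hE _ _ (hElt _ _ hij), hw, if_neg hj, mul_zero, add_zero]
    refine ⟨E, hBD.trans (orbitRel_eliminate D ρ c u w (fun k hk => if_neg hk.not_gt)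
      (fun k hk => if_neg hk.not_gt) hE), hElt, fun i j hi hij => ?_⟩
    rcases (Nat.lt_succ_iff.1 hi).lt_or_eq with hi | hi
    · have hiρ : i < ρ := hi
      have hEi : ∀ j', E i j' ≠ 0 → D i j' ≠ 0 := by
        intro j' hj'
        have hjc : j' ≠ c := by
          rintro rfl
          exact hiρ.ne (hcol i hj')
        rwa [hEc i j' hjc hj', hDc i hiρ, zero_mul, add_zero] at hj'
      have hjc : j ≠ c := by
        rintro rfl
        exact hiρ.ne (hcol i hij)
      obtain ⟨h1, h2⟩ := hD i j hi (hEi j hij)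
      refine ⟨fun j' hj' => h1 j' (hEi j' hj'), fun i' hi' => h2 i' ?_⟩
      -- Columns of earlier pivots are zero in row `ρ`, so the column operation leaves them alone.
      have hwj : w j = 0 := by
        have : D ρ j = 0 := by
          by_contra h
          exact hiρ.ne (h2 ρ h).symm
        simp [w, this]
      rwa [hEc i' j hjc hi', hwj, mul_zero, add_zero] at hi'
    · obtain rfl : i = ρ := Fin.ext hi
      obtain rfl := hrow j hij
      exact ⟨hrow, hcol⟩

/-- Every two-sided orbit of linear forms contains a rook matrix. -/
theorem exists_isRook_orbitRel (B : Matrix (Fin n) (Fin n) F) :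
    ∃ A : Matrix (Fin n) (Fin n) F, IsRook A ∧ OrbitRel B A := by
  obtain ⟨A, hBA, hlt, hA⟩ := exists_orbitRel_partial_rook B n le_rfl
  exact ⟨A, ⟨fun h => hlt _ _ h, fun h h' => ((hA _ _ (Fin.is_lt _) h).1 _ h').symm,
    fun h h' => ((hA _ _ (Fin.is_lt _) h).2 _ h').symm⟩, hBA⟩

variable [Fintype (U n F)] {θ : AddChar F ℂ}

theorem superSum_eq_of_orbitRel {A B : Matrix (Fin n) (Fin n) F} (h : OrbitRel A B) :
    superSum θ A = superSum θ B := by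
  obtain ⟨x₀, y₀, h⟩ := h
  ext g
  unfold superSum
  refine (Fintype.sum_equiv (Equiv.mulLeft x₀) _ _ fun x =>
    Fintype.sum_equiv (Equiv.mulRight y₀) _ _ fun y => ?_).symm
  rw [← h _ (mul_mem_strictUpper_right y (mul_mem_strictUpper_left x (mat_sub_one_mem g)))]
  simp only [Equiv.coe_mulLeft, Equiv.coe_mulRight, mat_mul, Matrix.mul_assoc]

/-- `(g - 1) g⁻¹ = -(g⁻¹ - 1)`, and the factor `g⁻¹` is absorbed into `y`. -/
theorem superSum_inv (A : Matrix (Fin n) (Fin n) F) (g : U n F) :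
    superSum θ A g⁻¹ =
      ∑ x : U n F, ∑ y : U n F, θ (-dot A (mat x * (mat g - 1) * mat y)) := by
  unfold superSum
  refine Finset.sum_congr rfl fun x _ => Fintype.sum_equiv (Equiv.mulLeft g⁻¹) _ _ fun y => ?_
  rw [Equiv.coe_mulLeft, mat_mul, ← map_neg]
  congr 2
  simp only [Matrix.sub_mul, Matrix.mul_sub, Matrix.mul_assoc, Matrix.one_mul]
  rw [← Matrix.mul_assoc (mat g), mat_mul_mat_inv, Matrix.one_mul, neg_sub]

theorem sum_sub_one_eq (hθ : θ ≠ 1) (l : Matrix (Fin n) (Fin n) F →ₗ[F] F)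
    [Decidable (∀ z ∈ strictUpper n F, l z = 0)] :
    ∑ g : U n F, θ (l (mat g - 1)) =
      if ∀ z ∈ strictUpper n F, l z = 0 then (Fintype.card (U n F) : ℂ) else 0 := by
  have h : ∀ g : U n F, θ (l (mat g - 1)) = θ (-l 1) * θ (l (mat g)) := fun g => by
    rw [← AddChar.map_add_eq_mul, map_sub, neg_add_eq_sub]
  rw [Finset.sum_congr rfl fun g _ => h g, ← Finset.mul_sum, sum_unitriangular_eq hθ, mul_ite,
    mul_zero, mul_left_comm, ← AddChar.map_add_eq_mul, neg_add_cancel, AddChar.map_zero_eq_one,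
    mul_one]

/-- Orbit sums of different orbits are orthogonal. -/
theorem pairing_superSum_eq_zero (hθ : θ ≠ 1) {A B : Matrix (Fin n) (Fin n) F}
    (h : ¬ OrbitRel A B) : pairing (superSum θ A) (superSum θ B) = 0 := by
  classical
  have key : ∀ x y x' y' : U n F, ∑ g : U n F, θ (dot A (mat x * (mat g - 1) * mat y)) *
      θ (-dot B (mat x' * (mat g - 1) * mat y')) = 0 := by
    intro x y x' y'
    have h1 := sum_sub_one_eq hθ
      (dot A ∘ₗ LinearMap.mulRight F (mat y) ∘ₗ LinearMap.mulLeft F (mat x) -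
        dot B ∘ₗ LinearMap.mulRight F (mat y') ∘ₗ LinearMap.mulLeft F (mat x'))
    simp only [← AddChar.map_add_eq_mul, ← sub_eq_add_neg]
    refine h1.trans (if_neg fun hz => ?_)
    -- A nonzero sum means both forms agree; substituting `x'⁻¹ z y'⁻¹` exhibits the excluded orbit
    -- relation.
    refine h ⟨x * x'⁻¹, y'⁻¹ * y, fun z hz' => ?_⟩
    have : dot A (mat x * (mat x'⁻¹ * z * mat y'⁻¹) * mat y) =
        dot B (mat x' * (mat x'⁻¹ * z * mat y'⁻¹) * mat y') := sub_eq_zero.1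
      (hz _ (mul_mem_strictUpper_right y'⁻¹ (mul_mem_strictUpper_left x'⁻¹ hz')))
    simp only [← Matrix.mul_assoc, mat_mul_mat_inv, Matrix.one_mul] at this
    rw [Matrix.mul_assoc z, mat_inv_mul_mat, Matrix.mul_one] at this
    rw [← this, mat_mul, mat_mul]
    simp only [Matrix.mul_assoc]
  have hAB : ∀ g : U n F, superSum θ A g * superSum θ B g⁻¹ =
      ∑ p : U n F × U n F, ∑ q : U n F × U n F, θ (dot A (mat p.1 * (mat g - 1) * mat p.2)) *
        θ (-dot B (mat q.1 * (mat g - 1) * mat q.2)) := fun g => by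
    rw [superSum_inv, superSum, ← Fintype.sum_prod_type', ← Fintype.sum_prod_type',
      Finset.sum_mul_sum]
  rw [pairing, Finset.sum_congr rfl fun g _ => hAB g, Finset.sum_comm]
  refine Finset.sum_eq_zero fun p _ => ?_
  rw [Finset.sum_comm]
  exact Finset.sum_eq_zero fun q _ => key _ _ _ _

theorem superSum_zero : superSum θ (0 : Matrix (Fin n) (Fin n) F) =
    ((Fintype.card (U n F) : ℂ) ^ 2) • (1 : U n F → ℂ) := by
  ext g
  simp [superSum, dot_eq_sum, sq]

/-- The sum of all orbit sums is supported at the identity. -/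
theorem sum_superSum (hθ : θ ≠ 1) [DecidableEq (U n F)] :
    ∑ h : U n F, superSum θ (mat h - 1) = Pi.single 1 ((Fintype.card (U n F) : ℂ) ^ 3) := by
  classical
  ext g
  -- As `h` varies, `h - 1` runs through all forms, so the sum detects `x (g - 1) y = 0`, that is `g
  -- = 1`.
  have key : ∀ x y : U n F, ∑ h : U n F, θ (dot (mat h - 1) (mat x * (mat g - 1) * mat y)) =
      if g = 1 then (Fintype.card (U n F) : ℂ) else 0 := by
    intro x y
    rw [Finset.sum_congr rfl fun h _ => congrArg θ (dot_comm (mat h - 1) _), sum_sub_one_eq hθ]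
    refine if_congr ⟨fun hz => ?_, ?_⟩ rfl rfl
    · have hm := mul_mem_strictUpper_right y (mul_mem_strictUpper_left x (mat_sub_one_mem g))
      have h0 : mat x * (mat g - 1) * mat y = 0 := by
        ext i j
        rcases le_or_gt j i with hij | hij
        · exact hm i j hij
        · simpa [dot_single] using hz _ (single_mem_strictUpper hij 1)
      have h1 : mat g - 1 = mat x⁻¹ * (mat x * (mat g - 1) * mat y) * mat y⁻¹ := by
        rw [Matrix.mul_assoc, Matrix.mul_assoc (mat x * _), mat_mul_mat_inv, Matrix.mul_one,
          ← Matrix.mul_assoc, mat_inv_mul_mat, Matrix.one_mul]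
      rw [h0, Matrix.mul_zero, Matrix.zero_mul, sub_eq_zero] at h1
      exact mat_injective h1
    · rintro rfl z -
      simp [mat_one, dot_eq_sum]
  simp only [Finset.sum_apply, superSum]
  rw [Finset.sum_comm, Finset.sum_congr rfl fun x _ =>
    (Finset.sum_comm.trans (Finset.sum_congr rfl fun y _ => key x y)), Pi.single_apply]
  split_ifs <;> simp
  ring

end Orbits

end AndreChar

namespace AndreChar

/-! ### Orthogonality and nonvanishing of irreducible characters. -/

section IrreducibleCharacters

open Representation

variable {G : Type*} [Group G] [Fintype G]

theorem eq_of_pairing_ne_zero {χ ψ : G → ℂ} (hχ : χ ∈ Irr G) (hψ : ψ ∈ Irr G)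
    (h : pairing χ ψ ≠ 0) : χ = ψ := by
  classical
  obtain ⟨d, ρ, hρ, rfl⟩ := hχ
  obtain ⟨e, σ, hσ, rfl⟩ := hψ
  have : Invertible (Nat.card G : ℂ) :=
    invertibleOfNonzero (Nat.cast_ne_zero.2 Nat.card_pos.ne')
  have h1 := char_orthonormal ρ σ
  by_cases he : Nonempty (Representation.Equiv σ ρ)
  · exact (char_iso he.some).symm
  · rw [if_neg he] at h1
    exact absurd ((mul_eq_zero.1 h1).resolve_left
      (inv_ne_zero (Nat.cast_ne_zero.2 Nat.card_pos.ne'))) h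

theorem apply_one_ne_zero_of_mem_Irr {χ : G → ℂ} (hχ : χ ∈ Irr G) : χ 1 ≠ 0 := by
  intro h
  have hself := pairing_self_of_mem_Irr hχ
  obtain ⟨d, ρ, hρ, rfl⟩ := hχ
  obtain rfl : d = 0 := by simpa using h
  have h0 : ρ.character = 0 := by
    ext g
    rw [character, Subsingleton.elim (ρ g) 0, map_zero, Pi.zero_apply]
  rw [h0] at hself
  simp [pairing, eq_comm] at hself

end IrreducibleCharacters

/-! ### Basic characters as orbit sums of rook matrices. -/

section BasicCharacters

variable {n : ℕ} {F : Type*} [Field F] (θ : AddChar F ℂ)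

/-- The rook matrix `A` encodes the index `p` of a basic character, the nonzero entries of `A`
being the parameters of the linear characters. -/
def Represents (A : Matrix (Fin n) (Fin n) F) (p : BasicIndex n F) : Prop :=
  rookRoots A = p.1.1 ∧
    ∀ α : p.1.1, (p.2 α).1 = entryChar θ α.1 (A α.1.row α.1.col)

variable {θ}

theorem Represents.index_eq {A : Matrix (Fin n) (Fin n) F} {p p' : BasicIndex n F}
    (h : Represents θ A p) (h' : Represents θ A p') : p = p' := by
  obtain ⟨⟨D, hD⟩, φ⟩ := p
  obtain ⟨⟨D', hD'⟩, φ'⟩ := p'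
  obtain ⟨h1, h2⟩ := h
  obtain ⟨h1', h2'⟩ := h'
  dsimp only at h1 h1' h2 h2'
  subst h1
  subst h1'
  congr 1
  funext α
  exact Subtype.ext ((h2 α).trans (h2' α).symm)

theorem exists_represents_of_isRook (hθ : θ.IsPrimitive) {A : Matrix (Fin n) (Fin n) F}
    (hA : IsRook A) (hA0 : A ≠ 0) : ∃ p, Represents θ A p := by
  have hD : IsBasic (rookRoots A) := by
    refine ⟨?_, fun α hα β hβ hne => ?_⟩
    · obtain ⟨i, j, hij⟩ : ∃ i j, A i j ≠ 0 := by
        by_contra! h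
        exact hA0 (Matrix.ext h)
      exact ⟨⟨(i, j), hA.lt hij⟩, mem_rookRoots.2 hij⟩
    · refine ⟨fun h => hne (hA.injOn_row hα hβ h), fun h => hne ?_⟩
      rw [Finset.mem_coe, mem_rookRoots] at hα hβ
      rw [← h] at hβ
      exact Subtype.ext (Prod.ext (hA.row_eq hα hβ) h)
  exact ⟨⟨⟨rookRoots A, hD⟩, fun α => ⟨entryChar θ α.1 (A α.1.row α.1.col),
    entryChar_mem_baseLinChars hθ α.1 (mem_rookRoots.1 α.2)⟩⟩, rfl, fun _ => rfl⟩

theorem exists_represents [Finite F] (hθ : θ.IsPrimitive) (p : BasicIndex n F) :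
    ∃ A, IsRook A ∧ A ≠ 0 ∧ Represents θ A p := by
  classical
  obtain ⟨⟨D, hD⟩, φ⟩ := p
  choose c hc0 hc using fun α : D => exists_eq_entryChar hθ (φ α).2
  let A : Matrix (Fin n) (Fin n) F := fun i j =>
    if h : ∃ hij : i < j, (⟨(i, j), hij⟩ : PosRoot n) ∈ D then c ⟨_, h.2⟩ else 0
  have hA : ∀ i j, A i j ≠ 0 → ∃ hij : i < j, (⟨(i, j), hij⟩ : PosRoot n) ∈ D := by
    intro i j hij
    by_contra h
    exact hij (dif_neg h)
  have hAD : ∀ α : D, A α.1.row α.1.col = c α := fun α => dif_pos ⟨α.1.2, α.2⟩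
  have hroots : rookRoots A = D := by
    ext α
    rw [mem_rookRoots]
    exact ⟨fun h => (hA _ _ h).2, fun h => by rw [hAD ⟨α, h⟩]; exact hc0 _⟩
  refine ⟨A, ⟨fun h => (hA _ _ h).1, fun {i j j'} h h' => ?_, fun {i i' j} h h' => ?_⟩, ?_, hroots,
    fun α => by rw [hAD α]; exact hc α⟩
  · obtain ⟨h1, h2⟩ := hA _ _ h
    obtain ⟨h1', h2'⟩ := hA _ _ h'
    by_contra hne
    exact (hD.2 h2 h2' fun he => hne (congrArg PosRoot.col he)).1 rfl
  · obtain ⟨h1, h2⟩ := hA _ _ h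
    obtain ⟨h1', h2'⟩ := hA _ _ h'
    by_contra hne
    exact (hD.2 h2 h2' fun he => hne (congrArg PosRoot.row he)).2 rfl
  · obtain ⟨α, hα⟩ := hD.1
    intro h
    refine hc0 ⟨α, hα⟩ ?_
    rw [← hAD ⟨α, hα⟩, h, Matrix.zero_apply]

variable [Fintype (U n F)]

theorem Represents.basicChar_eq (hθ : θ ≠ 1) {A : Matrix (Fin n) (Fin n) F} (hA : IsRook A)
    {p : BasicIndex n F} (h : Represents θ A p) :
    ∃ K : ℂ, K ≠ 0 ∧ basicChar p = K • superSum θ A := by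
  obtain ⟨K, hK, hprod⟩ := hA.prod_inducedChar hθ
  refine ⟨K, hK, ?_⟩
  rw [← hprod, h.1, basicChar, Finset.prod_congr rfl fun α _ => by rw [h.2 α],
    Finset.prod_coe_sort p.1.1 fun α =>
      inducedChar (baseGroup F α) (entryChar θ α (A α.row α.col))]

theorem isCharacter_basicChar (p : BasicIndex n F) : IsCharacter (basicChar p) :=
  IsCharacter.prod _ fun _ _ => isCharacter_inducedChar _ _

theorem superSum_apply_one (A : Matrix (Fin n) (Fin n) F) :
    superSum θ A 1 = (Fintype.card (U n F) : ℂ) ^ 2 := by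
  simp [superSum, mat_one, sq]

theorem constituents_basicChar_nonempty [Finite F] (hθ : θ ≠ 1) (p : BasicIndex n F) :
    (constituents (basicChar p)).Nonempty := by
  obtain ⟨A, hA, -, h⟩ := exists_represents (AddChar.IsPrimitive.of_ne_one hθ) p
  obtain ⟨K, hK, hp⟩ := h.basicChar_eq hθ hA
  refine exists_mem_constituents (isCharacter_basicChar p) ?_
  rw [hp, Pi.smul_apply, superSum_apply_one]
  exact mul_ne_zero hK (pow_ne_zero _ (Nat.cast_ne_zero.2 Fintype.card_ne_zero))

theorem disjoint_constituents_basicChar [Finite F] (hθ : θ ≠ 1) {p p' : BasicIndex n F}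
    (hne : p ≠ p') : Disjoint (constituents (basicChar p)) (constituents (basicChar p')) := by
  rw [Set.disjoint_left]
  intro χ h h'
  obtain ⟨A, hA, -, hAp⟩ := exists_represents (AddChar.IsPrimitive.of_ne_one hθ) p
  obtain ⟨A', hA', -, hAp'⟩ := exists_represents (AddChar.IsPrimitive.of_ne_one hθ) p'
  obtain ⟨K, hK, hp⟩ := hAp.basicChar_eq hθ hA
  obtain ⟨K', hK', hp'⟩ := hAp'.basicChar_eq hθ hA'
  have := pairing_ne_zero_of_mem_constituents h h'
  rw [hp, hp', pairing_smul_left, pairing_smul_right] at this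
  by_cases hAA : OrbitRel A A'
  · obtain rfl := hA.eq_of_orbitRel hA' hAA
    exact hne (hAp.index_eq hAp')
  · rw [pairing_superSum_eq_zero hθ hAA, mul_zero, mul_zero] at this
    exact this rfl

/-- `1_U` is a multiple of the orbit sum of the zero rook matrix, which is not in the orbit of a
nonzero one. -/
theorem one_notMem_constituents_basicChar [Finite F] (hθ : θ ≠ 1) (p : BasicIndex n F) :
    1 ∉ constituents (basicChar p) := by
  intro h
  obtain ⟨A, hA, hA0, hAp⟩ := exists_represents (AddChar.IsPrimitive.of_ne_one hθ) p
  obtain ⟨K, hK, hp⟩ := hAp.basicChar_eq hθ hA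
  have h1 : (1 : U n F → ℂ) ∈ constituents 1 :=
    ⟨one_mem_Irr, 0, isCharacter_zero, (add_zero _).symm⟩
  refine pairing_ne_zero_of_mem_constituents h h1 ?_
  have h0 := pairing_superSum_eq_zero hθ fun h => hA0 (hA.eq_of_orbitRel isRook_zero h)
  rw [superSum_zero, pairing_smul_right] at h0
  rw [hp, pairing_smul_left, (mul_eq_zero.1 h0).resolve_left
    (pow_ne_zero _ (Nat.cast_ne_zero.2 Fintype.card_ne_zero)), mul_zero]

/-- Pairing `χ` with the sum of all orbit sums gives a nonzero multiple of `χ 1`, so some orbit sum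
is not orthogonal to `χ`. Its rook matrix is nonzero, as otherwise `χ = 1`. -/
theorem exists_mem_constituents_basicChar (hθ : θ ≠ 1) {χ : U n F → ℂ} (hχ : χ ∈ Irr (U n F))
    (hχ1 : χ ≠ 1) : ∃ p : BasicIndex n F, χ ∈ constituents (basicChar p) := by
  classical
  have hU : (Fintype.card (U n F) : ℂ) ≠ 0 := Nat.cast_ne_zero.2 Fintype.card_ne_zero
  have hsum : ∑ h : U n F, pairing χ (superSum θ (mat h - 1)) ≠ 0 := by
    rw [← pairing_sum_right, sum_superSum hθ, pairing_comm, pairing, Finset.sum_eq_single 1]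
    · rw [Pi.single_eq_same, inv_one]
      exact mul_ne_zero (pow_ne_zero _ hU) (apply_one_ne_zero_of_mem_Irr hχ)
    · intro g _ hg
      rw [Pi.single_eq_of_ne hg, zero_mul]
    · simp
  obtain ⟨h, -, hh⟩ := Finset.exists_ne_zero_of_sum_ne_zero hsum
  obtain ⟨A, hA, hhA⟩ := exists_isRook_orbitRel (mat h - 1)
  rw [superSum_eq_of_orbitRel hhA] at hh
  have hA0 : A ≠ 0 := by
    rintro rfl
    rw [superSum_zero, pairing_smul_right] at hh
    exact hχ1 (eq_of_pairing_ne_zero hχ one_mem_Irr (right_ne_zero_of_mul hh))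
  obtain ⟨p, hp⟩ := exists_represents_of_isRook (AddChar.IsPrimitive.of_ne_one hθ) hA hA0
  obtain ⟨K, hK, hpK⟩ := hp.basicChar_eq hθ hA
  refine ⟨p, mem_constituents_of_pairing_ne_zero hχ (isCharacter_basicChar p) ?_⟩
  rw [hpK, pairing_smul_left, pairing_comm]
  exact mul_ne_zero hK hh

end BasicCharacters

end AndreChar

theorem theorem2p2 (n : ℕ) (F : Type*) [Field F] [Finite F] :
    (∀ χ ∈ AndreChar.Irr (AndreChar.U n F), χ ≠ 1 →
      ∃! p : AndreChar.BasicIndex n F, χ ∈ AndreChar.constituents (AndreChar.basicChar p)) ∧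
    (∀ p : AndreChar.BasicIndex n F,
      (AndreChar.constituents (AndreChar.basicChar p)).Nonempty ∧
        1 ∉ AndreChar.constituents (AndreChar.basicChar p)) ∧
    (∀ p p' : AndreChar.BasicIndex n F, p ≠ p' →
      Disjoint (AndreChar.constituents (AndreChar.basicChar p))
        (AndreChar.constituents (AndreChar.basicChar p'))) ∧
    {1} ∪ (⋃ p : AndreChar.BasicIndex n F,
      AndreChar.constituents (AndreChar.basicChar p)) = AndreChar.Irr (AndreChar.U n F) := by
  have : Finite (AndreChar.U n F) := Finite.of_injective _ AndreChar.mat_injective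
  have := Fintype.ofFinite (AndreChar.U n F)
  obtain ⟨θ, hθ1⟩ := (AddChar.exists_apply_ne_zero (a := (1 : F))).2 one_ne_zero
  have hθ : θ ≠ 1 := AddChar.ne_one_iff.2 ⟨1, hθ1⟩
  refine ⟨fun χ hχ hχ1 => ?_, fun p => ⟨AndreChar.constituents_basicChar_nonempty hθ p,
    AndreChar.one_notMem_constituents_basicChar hθ p⟩,
    fun p p' => AndreChar.disjoint_constituents_basicChar hθ, ?_⟩
  · obtain ⟨p, hp⟩ := AndreChar.exists_mem_constituents_basicChar hθ hχ hχ1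
    refine ⟨p, hp, fun p' hp' => ?_⟩
    by_contra hne
    exact Set.disjoint_left.1 (AndreChar.disjoint_constituents_basicChar hθ hne) hp' hp
  · refine Set.Subset.antisymm (Set.union_subset ?_ (Set.iUnion_subset fun p χ h => h.1))
      fun χ hχ => ?_
    · rintro _ rfl
      exact AndreChar.one_mem_Irr
    · by_cases hχ1 : χ = 1
      · exact Or.inl hχ1
      · exact Or.inr (Set.mem_iUnion.2
          (AndreChar.exists_mem_constituents_basicChar hθ hχ hχ1))
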